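/- Write $2^{<\omega}$ for the set of finite binary strings, $\varepsilon$ for the empty string, $\preceq$ for the initial segment relation, $\lambda$ for the uniform measure on $2^\omega$, and $[\![S]\!]$ for the set of all $X\in 2^\omega$ that have some $\sigma\in S$ as an initial segment, where $S\subseteq 2^{<\omega}$. A Turing functional $\Phi$ is a c.e. set of pairs of strings such that, whenever $(\sigma,\tau),(\sigma',\tau')\in\Phi$ and $\sigma\preceq\sigma'$, then $\tau\preceq\tau'$ or $\tau'\preceq\tau$. For $X\in 2^\omega$, $\Phi^X$ is the (finite or infinite) limit of all strings $\tau$ such that $(X{\upharpoonright}n,\tau)\in\Phi$ for some $n$ (and $\Phi^X=\varepsilon$ if there are none); $\mathrm{dom}(\Phi)$ is the set of $X\in 2^\omega$ for which $\Phi^X$ is infinite, and for such $X$ we write $\Phi(X)=\Phi^X$. Let $\lambda_\Phi(\sigma)=\lambda(\{X:\Phi^X\succeq\sigma\})$. A semi-measure is a function $\rho:2^{<\omega}\to[0,1]$ with $\rho(\varepsilon)=1$ and $\rho(\sigma)\ge\rho(\sigma0)+\rho(\sigma1)$ for all $\sigma$. It is left-c.e. if there is a computable function $\tilde\rho$ from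 $2^{<\omega}\times\omega$ to the non-negative dyadic rationals such that, for every $\sigma$, $\tilde\rho(\sigma,i)$ is non-decreasing in $i$ and converges to $\rho(\sigma)$ as $i\to\infty$. For $S\subseteq 2^{<\omega}$ put $\rho(S)=\sum_{\sigma\in S}\rho(\sigma)$. A sequence $X\in 2^\omega$ is 2-random if $X\notin\bigcap_i[\![U_i]\!]$ for every uniformly $\emptyset'$-c.e. sequence $(U_i)_{i\in\omega}$ of subsets of $2^{<\omega}$ with $\lambda([\![U_i]\!])\le 2^{-i}$ for all $i$. It is $\rho$-2-random if $X\notin\bigcap_i[\![U_i]\!]$ for every uniformly $\emptyset'$-c.e. sequence $(U_i)_{i\in\omega}$ of subsets of $2^{<\omega}$ with $\rho(U_i)\le 2^{-i}$ for all $i$. Corollary. Let $\rho$ be a left-c.e. semi-measure, and let $\Phi$ be a Turing functional such that $\rho=\lambda_\Phi$. (i) If $X\in\mathrm{dom}(\Phi)$ is 2-random, then $\Phi(X)$ is $\rho$-2-random. (ii) If $Y$ is $\rho$-2-random, then there is a 2-random $X\in\mathrm{dom}(\Phi)$ such that $\Phi(X)=Y$. -/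

import Mathlib

open MeasureTheory
open scoped ENNReal

/-! ### Cantor space, strings, and the uniform measure -/

/-- `initSeg X n` is the string consisting of the first `n` bits of `X`. -/
def initSeg (X : ℕ → Bool) (n : ℕ) : List Bool := (List.range n).map X

/-- The cylinder of all infinite binary sequences that have `σ` as an initial segment. -/
def cylinderSet (σ : List Bool) : Set (ℕ → Bool) := {X | initSeg X σ.length = σ}

/-- The open set generated by a set of strings. -/
def openOf (S : Set (List Bool)) : Set (ℕ → Bool) := ⋃ σ ∈ S, cylinderSet σ

/-- The uniform (Lebesgue) measure on Cantor space: the infinite product of the uniform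
probability measure on `{0, 1}`. -/
noncomputable def uniformMeasure : Measure (ℕ → Bool) :=
  Measure.infinitePi fun _ => (PMF.uniformOfFintype Bool).toMeasure

/-! ### Turing functionals -/

/-- A Turing functional, presented as a c.e. set of pairs of strings which is consistent:
comparable inputs are mapped to comparable outputs. -/
structure TuringFunctional where
  /-- the set of pairs -/
  pairs : Set (List Bool × List Bool)
  ce : REPred fun p : List Bool × List Bool => p ∈ pairs
  consistent : ∀ σ τ σ' τ' : List Bool, (σ, τ) ∈ pairs → (σ', τ') ∈ pairs → σ <+: σ' →
    τ <+: τ' ∨ τ' <+: τ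

namespace TuringFunctional

/-- `Φ.Extends X τ` says that `τ` is an initial segment of the (finite or infinite) output
`Φ^X`, which is the limit of all `τ'` such that `(X ↾ n, τ') ∈ Φ` for some `n`
(and is the empty string if there are none). -/
def Extends (Φ : TuringFunctional) (X : ℕ → Bool) (τ : List Bool) : Prop :=
  τ = [] ∨ ∃ n τ', (initSeg X n, τ') ∈ Φ.pairs ∧ τ <+: τ'

/-- The partial map on Cantor space given by `Φ`. Its domain consists of those `X` for which
`Φ^X` is infinite, and its value there is `Φ^X`. -/
noncomputable def toPFun (Φ : TuringFunctional) : (ℕ → Bool) →. (ℕ → Bool) := fun X =>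
  ⟨∃ Y : ℕ → Bool, ∀ n, Φ.Extends X (initSeg Y n), fun h => h.choose⟩

/-- The function `σ ↦ λ {X : σ ≼ Φ^X}` induced by `Φ`. -/
noncomputable def induced (Φ : TuringFunctional) (σ : List Bool) : ℝ :=
  uniformMeasure.real {X | Φ.Extends X σ}

end TuringFunctional

/-! ### Semi-measures -/

/-- A semi-measure on the set of finite binary strings, with values in `[0, 1]`. -/
structure IsSemimeasure (ρ : List Bool → ℝ) : Prop where
  mem_Icc : ∀ σ, ρ σ ∈ Set.Icc (0 : ℝ) 1
  root : ρ [] = 1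
  split : ∀ σ, ρ (σ ++ [false]) + ρ (σ ++ [true]) ≤ ρ σ

/-- `ρ` is left-c.e.: its values are uniformly limits of computable non-decreasing sequences of
non-negative dyadic rationals, the dyadic rational `m / 2 ^ k` being given by `(m, k)`. -/
def IsLeftCE (ρ : List Bool → ℝ) : Prop :=
  ∃ q : List Bool → ℕ → ℕ × ℕ, Computable₂ q ∧ ∀ σ,
    Monotone (fun i => ((q σ i).1 : ℝ) / 2 ^ (q σ i).2) ∧
    Filter.Tendsto (fun i => ((q σ i).1 : ℝ) / 2 ^ (q σ i).2) Filter.atTop (nhds (ρ σ))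

/-- `ρ(S) = ∑_{σ ∈ S} ρ(σ)` for a set `S` of strings. -/
noncomputable def weight (ρ : List Bool → ℝ) (S : Set (List Bool)) : ℝ≥0∞ :=
  ∑' σ : S, ENNReal.ofReal (ρ σ)

/-! ### Enumerability relative to the halting problem -/

/-- The halting set `∅'`: the set of all `e` such that the `e`-th partial computable function
is defined at `e`. -/
def haltingSet : Set ℕ := {e | ((Denumerable.ofNat Nat.Partrec.Code e).eval e).Dom}

open scoped Classical in
/-- The characteristic function of `∅'`, as an oracle. -/
noncomputable def haltingOracle : ℕ →. ℕ := fun e => Part.some (if e ∈ haltingSet then 1 else 0)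

/-- A sequence of sets of strings is uniformly `∅'`-c.e. if the set of pairs `(i, σ)` with
`σ ∈ U i` is the domain of a partial function that is recursive in `∅'`. -/
def UniformlyHaltingCE (U : ℕ → Set (List Bool)) : Prop :=
  ∃ f : ℕ × List Bool →. Unit, RecursiveIn {haltingOracle} f ∧ ∀ i σ, σ ∈ U i ↔ (f (i, σ)).Dom

/-! ### 2-randomness -/

/-- 2-randomness with respect to the uniform measure, that is, Martin-Löf randomness
relative to `∅'`. -/
def TwoRandom (X : ℕ → Bool) : Prop :=
  ∀ U : ℕ → Set (List Bool), UniformlyHaltingCE U →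
    (∀ i, uniformMeasure (openOf (U i)) ≤ 2⁻¹ ^ i) → X ∉ ⋂ i, openOf (U i)

/-- 2-randomness with respect to `ρ`: passing every `∅'`-Martin-Löf test for `ρ`. -/
def SemimeasureTwoRandom (ρ : List Bool → ℝ) (X : ℕ → Bool) : Prop :=
  ∀ U : ℕ → Set (List Bool), UniformlyHaltingCE U →
    (∀ i, weight ρ (U i) ≤ 2⁻¹ ^ i) → X ∉ ⋂ i, openOf (U i)

/-! For (i), pull a `ρ`-test back along `Φ`. The oracles sent into `⟦U i⟧` form the union of the
preimages of the `τ ∈ U i`, whose measure is at most `∑ λ_Φ(τ) = ρ(U i)`. A test failed by `Φ(X)`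
thus becomes an ordinary test failed by `X`.

For (ii), take a set of strings `A k` that contains a component of a universal `∅'`-test and
satisfies `λ⟦A k⟧ ≤ 2⁻ᵏ`. Let `V k` be the set of `σ` whose whole preimage lies in `⟦A k⟧`. Once `V
k` is made prefix-free, its members have disjoint preimages, so its `ρ`-weight is at most `2⁻ᵏ`. If
`V` is a test, a `ρ`-2-random `Y` avoids some `⟦V k⟧`. Then the sets `Φ⁻¹(Y↾n) \ ⟦A k⟧` are nonempty
and decreasing, and a point of their intersection is a 2-random oracle computing `Y`.

Two steps need compactness, whereas preimages of strings are only open: `V` has to be `∅'`-c.e., and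
the intersection has to be nonempty. The remedy is to put into `A k` also the oracles that enter a
preimage late, after a stage exhausting it up to tiny measure (`lateSet`). Outside `⟦A k⟧` every
preimage then agrees with a clopen set. `preimage_subset_openOf_iff` and `exists_mem_toPFun` rest on
this.

Enumerability in `∅'` is handled throughout as `Σ₂` definability. The equivalence
(`uniformlyHaltingCE_iff`, a case of Post's theorem) reduces every effectivity claim to closure
properties of `IsSigma2`. -/

/-! ### Predicates with one alternation of quantifiers -/

section Sigma2

variable {α β : Type*} [Primcodable α] [Primcodable β]

namespace PrimrecPred

theorem forall_mem {p : α × β → Prop} (hp : PrimrecPred p) {l : α → List β} (hl : Primrec l) :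
    PrimrecPred fun x => ∀ y ∈ l x, p (x, y) := by
  have h : PrimrecRel fun (y : β) (x : α) => p (x, y) :=
    hp.comp (Primrec.snd.pair Primrec.fst)
  exact h.forall_mem_list.comp hl Primrec.id

theorem exists_mem {p : α × β → Prop} (hp : PrimrecPred p) {l : α → List β} (hl : Primrec l) :
    PrimrecPred fun x => ∃ y ∈ l x, p (x, y) := by
  have h : PrimrecRel fun (y : β) (x : α) => p (x, y) :=
    hp.comp (Primrec.snd.pair Primrec.fst)
  exact h.exists_mem_list.comp hl Primrec.id

theorem forall_lt' {p : α × ℕ → Prop} (hp : PrimrecPred p) {f : α → ℕ} (hf : Primrec f) :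
    PrimrecPred fun x => ∀ n < f x, p (x, n) :=
  (hp.forall_mem (Primrec.list_range.comp hf)).of_eq (by simp)

theorem exists_lt' {p : α × ℕ → Prop} (hp : PrimrecPred p) {f : α → ℕ} (hf : Primrec f) :
    PrimrecPred fun x => ∃ n < f x, p (x, n) :=
  (hp.exists_mem (Primrec.list_range.comp hf)).of_eq (by simp)

end PrimrecPred

/-- `p` is definable with an unbounded existential quantifier followed by an unbounded universal
one over a primitive recursive matrix. -/
def IsSigma2 (p : α → Prop) : Prop :=
  ∃ q : (α × ℕ) × ℕ → Prop, PrimrecPred q ∧ ∀ x, p x ↔ ∃ a, ∀ b, q ((x, a), b)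

/-- `p` is definable with an unbounded existential quantifier over a primitive recursive matrix. -/
def IsSigma1 (p : α → Prop) : Prop :=
  ∃ q : α × ℕ → Prop, PrimrecPred q ∧ ∀ x, p x ↔ ∃ a, q (x, a)

namespace IsSigma2

theorem of_eq {p q : α → Prop} (hp : IsSigma2 p) (h : ∀ x, p x ↔ q x) : IsSigma2 q :=
  (funext fun x => propext (h x) : p = q) ▸ hp

theorem comp {p : β → Prop} (hp : IsSigma2 p) {f : α → β} (hf : Primrec f) :
    IsSigma2 fun x => p (f x) := by
  obtain ⟨q, hq, h⟩ := hp
  exact ⟨fun z => q ((f z.1.1, z.1.2), z.2), hq.comp (((hf.comp (Primrec.fst.comp Primrec.fst)).pair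
    (Primrec.snd.comp Primrec.fst)).pair Primrec.snd), fun x => h _⟩

theorem of_primrec {p : α → Prop} (hp : PrimrecPred p) : IsSigma2 p :=
  ⟨fun z => p z.1.1, hp.comp (Primrec.fst.comp Primrec.fst), fun x => by simp⟩

theorem of_sigma1 {p : α → Prop} (hp : IsSigma1 p) : IsSigma2 p := by
  obtain ⟨q, hq, h⟩ := hp
  exact ⟨fun z => q z.1, hq.comp Primrec.fst, fun x => by simp [h]⟩

theorem of_forall {p : α × ℕ → Prop} (hp : PrimrecPred p) : IsSigma2 fun x => ∀ b, p (x, b) :=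
  ⟨fun z => p (z.1.1, z.2), hp.comp ((Primrec.fst.comp Primrec.fst).pair Primrec.snd),
    fun x => by simp⟩

theorem not_of_sigma1 {p : α → Prop} (hp : IsSigma1 p) : IsSigma2 fun x => ¬ p x := by
  obtain ⟨q, hq, h⟩ := hp
  exact (of_forall hq.not).of_eq fun x => by simp [h]

theorem or {p q : α → Prop} (hp : IsSigma2 p) (hq : IsSigma2 q) :
    IsSigma2 fun x => p x ∨ q x := by
  obtain ⟨p', hp', h⟩ := hp
  obtain ⟨q', hq', h'⟩ := hq
  have ht : Primrec fun z : (α × ℕ) × ℕ => ((z.1.1, z.1.2.unpair.2), z.2) :=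
    ((Primrec.fst.comp Primrec.fst).pair (Primrec.snd.comp (Primrec.unpair.comp
      (Primrec.snd.comp Primrec.fst)))).pair Primrec.snd
  have h0 : PrimrecPred fun z : (α × ℕ) × ℕ => z.1.2.unpair.1 = 0 :=
    Primrec.eq.comp (Primrec.fst.comp (Primrec.unpair.comp (Primrec.snd.comp Primrec.fst)))
      (Primrec.const 0)
  refine ⟨fun z => (z.1.2.unpair.1 = 0 ∧ p' ((z.1.1, z.1.2.unpair.2), z.2)) ∨
    (¬ z.1.2.unpair.1 = 0 ∧ q' ((z.1.1, z.1.2.unpair.2), z.2)),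
    (h0.and (hp'.comp ht)).or (h0.not.and (hq'.comp ht)), fun x => ?_⟩
  simp only [h, h']
  constructor
  · rintro (⟨a, ha⟩ | ⟨a, ha⟩)
    · exact ⟨Nat.pair 0 a, by simpa using ha⟩
    · exact ⟨Nat.pair 1 a, by simpa using ha⟩
  · rintro ⟨a, ha⟩
    by_cases h : a.unpair.1 = 0
    · exact .inl ⟨a.unpair.2, by simpa [h] using ha⟩
    · exact .inr ⟨a.unpair.2, by simpa [h] using ha⟩

theorem exists_nat {p : α × ℕ → Prop} (hp : IsSigma2 p) : IsSigma2 fun x => ∃ n, p (x, n) := by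
  obtain ⟨q, hq, h⟩ := hp
  have hu : Primrec fun z : (α × ℕ) × ℕ => z.1.2.unpair :=
    Primrec.unpair.comp (Primrec.snd.comp Primrec.fst)
  refine ⟨fun z => q (((z.1.1, z.1.2.unpair.1), z.1.2.unpair.2), z.2),
    hq.comp ((((Primrec.fst.comp Primrec.fst).pair (Primrec.fst.comp hu)).pair
      (Primrec.snd.comp hu)).pair Primrec.snd), fun x => ?_⟩
  simp only [h]
  constructor
  · rintro ⟨n, a, ha⟩
    exact ⟨Nat.pair n a, by simpa using ha⟩
  · rintro ⟨a, ha⟩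
    exact ⟨_, _, ha⟩

theorem exists_of_inhabited [Inhabited β] {p : α × β → Prop} (hp : IsSigma2 p) :
    IsSigma2 fun x => ∃ y, p (x, y) := by
  have hd : Primrec fun z : α × ℕ => (z.1, (Encodable.decode (α := β) z.2).getD default) :=
    Primrec.fst.pair (Primrec.option_getD.comp (Primrec.decode.comp Primrec.snd)
      (Primrec.const default))
  refine (hp.comp hd).exists_nat.of_eq fun x => ⟨fun ⟨n, h⟩ => ⟨_, h⟩, fun ⟨y, h⟩ =>
    ⟨Encodable.encode y, by simpa using h⟩⟩

/-- Collection: the normal form is `∃ A, ∀ B, ∀ y ∈ l x, ∃ a < A, ∀ b < B, q`, whose matrix is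
primitive recursive. If some `y` had no witness, a `B` above the counterexamples to all `a < A`
would refute it. -/
theorem forall_mem {p : α × β → Prop} (hp : IsSigma2 p) {l : α → List β} (hl : Primrec l) :
    IsSigma2 fun x => ∀ y ∈ l x, p (x, y) := by
  obtain ⟨q, hq, h⟩ := hp
  have hq₁ : PrimrecPred fun z : (((α × ℕ) × ℕ) × β) =>
      ∃ a < z.1.1.2, ∀ b < z.1.2, q (((z.1.1.1, z.2), a), b) := by
    have hq₂ : PrimrecPred fun w : ((((α × ℕ) × ℕ) × β) × ℕ) × ℕ =>
        q (((w.1.1.1.1.1, w.1.1.2), w.1.2), w.2) := by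
      have f := Primrec.fst (α := ((((α × ℕ) × ℕ) × β) × ℕ)) (β := ℕ)
      have ff := Primrec.fst.comp f
      exact hq.comp ((((Primrec.fst.comp (Primrec.fst.comp (Primrec.fst.comp ff))).pair
        (Primrec.snd.comp ff)).pair (Primrec.snd.comp f)).pair Primrec.snd)
    have hq₃ := hq₂.forall_lt' (f := fun w => w.1.1.2)
      (Primrec.snd.comp (Primrec.fst.comp Primrec.fst))
    exact hq₃.exists_lt' (f := fun z => z.1.1.2)
      (Primrec.snd.comp (Primrec.fst.comp Primrec.fst))
  refine ⟨_, hq₁.forall_mem (l := fun z => l z.1.1) (hl.comp (Primrec.fst.comp Primrec.fst)),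
    fun x => ?_⟩
  simp only [h]
  constructor
  · intro hx
    choose! a ha using hx
    refine ⟨((l x).map a).sum + 1, fun B y hy => ⟨a y, ?_, fun b _ => ha y hy b⟩⟩
    exact Nat.lt_succ_of_le (List.single_le_sum (by simp) _ (List.mem_map_of_mem hy))
  · rintro ⟨A, hA⟩ y hy
    by_contra! hc
    choose b hb using hc
    obtain ⟨a, ha, hab⟩ := hA (((List.range A).map b).sum + 1) y hy
    exact hb a (hab _ (Nat.lt_succ_of_le (List.single_le_sum (by simp) _
      (List.mem_map_of_mem (List.mem_range.2 ha)))))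

theorem forall_lt {p : α × ℕ → Prop} (hp : IsSigma2 p) {f : α → ℕ} (hf : Primrec f) :
    IsSigma2 fun x => ∀ n < f x, p (x, n) :=
  (hp.forall_mem (Primrec.list_range.comp hf)).of_eq (by simp)

theorem and {p q : α → Prop} (hp : IsSigma2 p) (hq : IsSigma2 q) :
    IsSigma2 fun x => p x ∧ q x := by
  obtain ⟨p', hp', h⟩ := hp
  obtain ⟨q', hq', h'⟩ := hq
  have f : Primrec fun z : (α × ℕ) × ℕ => z.1.1 := Primrec.fst.comp Primrec.fst
  have hu : Primrec fun z : (α × ℕ) × ℕ => z.1.2.unpair :=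
    Primrec.unpair.comp (Primrec.snd.comp Primrec.fst)
  refine ⟨fun z => p' ((z.1.1, z.1.2.unpair.1), z.2) ∧ q' ((z.1.1, z.1.2.unpair.2), z.2),
    (hp'.comp ((f.pair (Primrec.fst.comp hu)).pair Primrec.snd)).and
      (hq'.comp ((f.pair (Primrec.snd.comp hu)).pair Primrec.snd)), fun x => ?_⟩
  simp only [h, h']
  constructor
  · rintro ⟨⟨a, ha⟩, ⟨b, hb⟩⟩
    exact ⟨Nat.pair a b, fun c => by simpa using ⟨ha c, hb c⟩⟩
  · rintro ⟨a, ha⟩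
    exact ⟨⟨_, fun b => (ha b).1⟩, ⟨_, fun b => (ha b).2⟩⟩

theorem exists_lt {p : α × ℕ → Prop} (hp : IsSigma2 p) {f : α → ℕ} (hf : Primrec f) :
    IsSigma2 fun x => ∃ n < f x, p (x, n) :=
  ((of_primrec (Primrec.nat_lt.comp Primrec.snd (hf.comp Primrec.fst))).and hp).exists_nat

end IsSigma2

/-! ### Quantifier forms and programs. -/

open Nat.Partrec (Code)
open Encodable

theorem PrimrecPred.evaln_isSome :
    PrimrecPred fun z : (ℕ × Code) × ℕ => (Code.evaln z.1.1 z.1.2 z.2).isSome = true :=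
  Primrec.eq.comp (Primrec.option_isSome.comp Code.primrec_evaln) (Primrec.const true)

theorem Nat.Partrec.Code.eval_dom_iff (c : Code) (n : ℕ) :
    (Code.eval c n).Dom ↔ ∃ k, (Code.evaln k c n).isSome = true := by
  rw [Part.dom_iff_mem]
  constructor
  · rintro ⟨y, hy⟩
    obtain ⟨k, hk⟩ := Code.evaln_complete.1 hy
    exact ⟨k, by rw [Option.mem_def.1 hk]; rfl⟩
  · rintro ⟨k, hk⟩
    obtain ⟨y, hy⟩ := Option.isSome_iff_exists.1 hk
    exact ⟨y, Code.evaln_complete.2 ⟨k, hy⟩⟩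

theorem IsSigma1.comp {p : β → Prop} (hp : IsSigma1 p) {f : α → β} (hf : Primrec f) :
    IsSigma1 fun x => p (f x) := by
  obtain ⟨q, hq, h⟩ := hp
  exact ⟨fun z => q (f z.1, z.2), hq.comp ((hf.comp Primrec.fst).pair Primrec.snd), fun x => h _⟩

theorem IsSigma1.eval_dom {f : α → Code} {g : α → ℕ} (hf : Primrec f) (hg : Primrec g) :
    IsSigma1 fun x => (Code.eval (f x) (g x)).Dom :=
  ⟨fun z => (Code.evaln z.2 (f z.1) (g z.1)).isSome = true,
    PrimrecPred.evaln_isSome.comp (((Primrec.snd.pair (hf.comp Primrec.fst))).pair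
      (hg.comp Primrec.fst)), fun _ => Code.eval_dom_iff _ _⟩

theorem REPred.exists_code {p : α → Prop} (hp : REPred p) :
    ∃ c : Code, ∀ x, p x ↔ (Code.eval c (encode x)).Dom := by
  obtain ⟨c, hc⟩ := Code.exists_code.1 hp
  exact ⟨c, fun x => by simp [hc, Part.dom_iff_mem]⟩

theorem REPred.isSigma1 {p : α → Prop} (hp : REPred p) : IsSigma1 p := by
  obtain ⟨c, hc⟩ := hp.exists_code
  obtain ⟨q, hq, h⟩ := IsSigma1.eval_dom (Primrec.const c) (Primrec.encode (α := α))
  exact ⟨q, hq, fun x => (hc x).trans (h x)⟩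

theorem IsSigma1.rePred {p : α → Prop} (hp : IsSigma1 p) : REPred p := by
  obtain ⟨q, ⟨_, hq⟩, h⟩ := hp
  have hr : Partrec fun x : α => Nat.rfind fun n => Part.some (decide (q (x, n))) :=
    Partrec.rfind hq.to_comp.partrec
  refine hr.dom_re.of_eq fun x => ?_
  rw [h]
  exact Nat.rfind_dom.trans (by simp)

/-- A `Σ₂` predicate holds exactly where a suitable program diverges at some second input. -/
theorem IsSigma2.exists_code {p : α → Prop} (hp : IsSigma2 p) :
    ∃ c : Code, ∀ x, p x ↔ ∃ a, ¬ (Code.eval c (Nat.pair (encode x) a)).Dom := by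
  obtain ⟨q, hq, h⟩ := hp
  have h1 : IsSigma1 fun x : α × ℕ => ∃ b, ¬ q (x, b) :=
    ⟨fun z => ¬ q z, hq.not, fun _ => Iff.rfl⟩
  obtain ⟨c, hc⟩ := h1.rePred.exists_code
  refine ⟨c, fun x => ?_⟩
  simp only [h]
  refine exists_congr fun a => ?_
  rw [← encode_nat a, ← encode_prod_val, ← hc]
  simp

end Sigma2

/-! ### Enumerability relative to the halting problem and quantifier alternation -/

section HaltingCE

open Nat.Partrec (Code)
open Encodable

namespace PFun

theorem mem_part_bind {p : Part ℕ} {f : ℕ →. ℕ} {y : ℕ} : y ∈ (p >>= f) ↔ ∃ x ∈ p, y ∈ f x :=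
  Part.mem_bind_iff

theorem some_part_bind (x : ℕ) (f : ℕ →. ℕ) : (Part.some x >>= f) = f x :=
  Part.bind_some _ _

theorem none_part_bind (f : ℕ →. ℕ) : (Part.none >>= f) = Part.none :=
  Part.bind_none _

end PFun

theorem isSigma1_haltingSet : IsSigma1 fun e : ℕ => e ∈ haltingSet :=
  IsSigma1.eval_dom (Primrec.ofNat Code) Primrec.id

/-- A list of intermediate values certifies a primitive recursion, which replaces the recursion by
an existential and a bounded universal quantifier. -/
theorem mem_natRec_iff_exists_list {f : Part ℕ} {h : ℕ → ℕ →. ℕ} {n y : ℕ} :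
    (y ∈ (Nat.rec f (fun m (IH : Part ℕ) => IH.bind (h m)) n : Part ℕ)) ↔
      ∃ l : List ℕ, (l.getD 0 0 ∈ f ∧ ∀ i < n, l.getD (i + 1) 0 ∈ h i (l.getD i 0)) ∧
        y = l.getD n 0 := by
  constructor
  · intro hy
    -- Fixing the length makes an appended value land at index `n + 1`; the default of `getD` is
    -- then never read.
    suffices ∃ l : List ℕ, l.length = n + 1 ∧
        (l.getD 0 0 ∈ f ∧ ∀ i < n, l.getD (i + 1) 0 ∈ h i (l.getD i 0)) ∧ y = l.getD n 0 from
      this.imp fun l hl => hl.2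
    induction n generalizing y with
    | zero => exact ⟨[y], by simpa using hy⟩
    | succ n ih =>
      obtain ⟨v, hv, hy⟩ := Part.mem_bind_iff.1 hy
      obtain ⟨l, hl, ⟨h0, hs⟩, rfl⟩ := ih hv
      have hlt : ∀ i < n + 1, (l ++ [y]).getD i 0 = l.getD i 0 := fun i hi => by
        simp [List.getD_eq_getElem?_getD, List.getElem?_append, hl, hi]
      have hlast : (l ++ [y]).getD (n + 1) 0 = y := by
        simp [List.getD_eq_getElem?_getD, ← hl]
      refine ⟨l ++ [y], by simp [hl], ⟨?_, fun i hi => ?_⟩, hlast.symm⟩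
      · rwa [hlt 0 (by omega)]
      · rw [hlt i hi]
        rcases Nat.lt_succ_iff_lt_or_eq.1 hi with hi' | rfl
        · rw [hlt _ (by omega)]
          exact hs i hi'
        · rwa [hlast]
  · rintro ⟨l, ⟨h0, hs⟩, rfl⟩
    induction n with
    | zero => exact h0
    | succ n ih =>
      exact Part.mem_bind_iff.2 ⟨_, ih fun i hi => hs i (by omega), hs n (by omega)⟩

theorem isSigma2_graph_of_primrec {g : ℕ → ℕ} (hg : Primrec g) :
    IsSigma2 fun z : ℕ × ℕ => z.2 ∈ Part.some (g z.1) :=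
  (IsSigma2.of_primrec (Primrec.eq.comp Primrec.snd (hg.comp Primrec.fst))).of_eq fun z => by
    simp

/-- Induction on the derivation. The oracle is the only source of `Σ₂` complexity: its graph
combines a `Σ₁` and a `Π₁` condition. -/
theorem isSigma2_graph_of_recursiveIn {f : ℕ →. ℕ} (hf : Nat.RecursiveIn {haltingOracle} f) :
    IsSigma2 fun z : ℕ × ℕ => z.2 ∈ f z.1 := by
  induction hf with
  | zero => exact isSigma2_graph_of_primrec (Primrec.const 0)
  | succ => exact isSigma2_graph_of_primrec Primrec.succ
  | left => exact isSigma2_graph_of_primrec (Primrec.fst.comp Primrec.unpair)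
  | right => exact isSigma2_graph_of_primrec (Primrec.snd.comp Primrec.unpair)
  | oracle g hg =>
    obtain rfl := Set.mem_singleton_iff.1 hg
    have h1 := (IsSigma2.of_sigma1 isSigma1_haltingSet).comp (Primrec.fst (α := ℕ) (β := ℕ))
    have h2 := (IsSigma2.not_of_sigma1 isSigma1_haltingSet).comp (Primrec.fst (α := ℕ) (β := ℕ))
    have e1 : IsSigma2 fun z : ℕ × ℕ => z.2 = 1 :=
      .of_primrec (Primrec.eq.comp Primrec.snd (Primrec.const 1))
    have e2 : IsSigma2 fun z : ℕ × ℕ => z.2 = 0 :=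
      .of_primrec (Primrec.eq.comp Primrec.snd (Primrec.const 0))
    refine ((h1.and e1).or (h2.and e2)).of_eq fun z => ?_
    by_cases h : z.1 ∈ haltingSet <;> simp [haltingOracle, h]
  | @pair f h _ _ hf hh =>
    have u : Primrec fun z : ℕ × ℕ => z.2.unpair := Primrec.unpair.comp Primrec.snd
    refine ((hf.comp (Primrec.fst.pair (Primrec.fst.comp u))).and
      (hh.comp (Primrec.fst.pair (Primrec.snd.comp u)))).of_eq fun z => ?_
    simp only [Seq.seq, Part.map_eq_map, Part.mem_bind_iff, Part.mem_map_iff]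
    constructor
    · rintro ⟨h1, h2⟩
      exact ⟨_, ⟨_, h1, rfl⟩, _, h2, by simp⟩
    · rintro ⟨_, ⟨a, ha, rfl⟩, b, hb, e⟩
      simp only [← e, Nat.unpair_pair]
      exact ⟨ha, hb⟩
  | @comp f h _ _ hf hh =>
    have h1 : IsSigma2 fun z : (ℕ × ℕ) × ℕ => z.2 ∈ h z.1.1 :=
      hh.comp ((Primrec.fst.comp Primrec.fst).pair Primrec.snd)
    have h2 : IsSigma2 fun z : (ℕ × ℕ) × ℕ => z.1.2 ∈ f z.2 :=
      hf.comp (Primrec.snd.pair (Primrec.snd.comp Primrec.fst))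
    exact (h1.and h2).exists_nat.of_eq fun z =>
      (PFun.mem_part_bind (p := h z.1) (f := f) (y := z.2)).symm
  | @prec f h _ _ hf hh =>
    have pa : Primrec fun z : (ℕ × ℕ) × List ℕ => z.1.1.unpair :=
      Primrec.unpair.comp (Primrec.fst.comp Primrec.fst)
    have get (g : (ℕ × ℕ) × List ℕ → ℕ) (hg : Primrec g) :
        Primrec fun z : (ℕ × ℕ) × List ℕ => z.2.getD (g z) 0 :=
      (Primrec.list_getD 0).comp Primrec.snd hg
    have h1 : IsSigma2 fun z : (ℕ × ℕ) × List ℕ => z.2.getD 0 0 ∈ f z.1.1.unpair.1 :=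
      hf.comp ((Primrec.fst.comp pa).pair (get _ (Primrec.const 0)))
    have h2 : IsSigma2 fun w : ((ℕ × ℕ) × List ℕ) × ℕ => w.1.2.getD (w.2 + 1) 0 ∈
        h (Nat.pair w.1.1.1.unpair.1 (Nat.pair w.2 (w.1.2.getD w.2 0))) := by
      have l : Primrec fun w : ((ℕ × ℕ) × List ℕ) × ℕ => w.1.2 := Primrec.snd.comp Primrec.fst
      exact hh.comp ((Primrec₂.natPair.comp (Primrec.fst.comp (pa.comp Primrec.fst))
        (Primrec₂.natPair.comp Primrec.snd ((Primrec.list_getD 0).comp l Primrec.snd))).pair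
          ((Primrec.list_getD 0).comp l (Primrec.succ.comp Primrec.snd)))
    have h3 : IsSigma2 fun z : (ℕ × ℕ) × List ℕ => z.1.2 = z.2.getD z.1.1.unpair.2 0 :=
      .of_primrec (Primrec.eq.comp (Primrec.snd.comp Primrec.fst)
        (get _ (Primrec.snd.comp pa)))
    refine ((h1.and (h2.forall_lt (Primrec.snd.comp pa))).and h3).exists_of_inhabited.of_eq
      fun z => ?_
    exact (mem_natRec_iff_exists_list (f := f z.1.unpair.1)
      (n := z.1.unpair.2) (y := z.2)
      (h := fun m i => h (Nat.pair z.1.unpair.1 (Nat.pair m i)))).symm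
  | @rfind f _ hf =>
    have h0 : IsSigma2 fun z : ℕ × ℕ => 0 ∈ f (Nat.pair z.1 z.2) :=
      hf.comp ((Primrec₂.natPair.comp Primrec.fst Primrec.snd).pair (Primrec.const 0))
    have h1 : IsSigma2 fun w : ((ℕ × ℕ) × ℕ) × ℕ => w.2 ∈ f (Nat.pair w.1.1.1 w.1.2) :=
      hf.comp ((Primrec₂.natPair.comp (Primrec.fst.comp (Primrec.fst.comp Primrec.fst))
        (Primrec.snd.comp Primrec.fst)).pair Primrec.snd)
    have h2 : IsSigma2 fun w : ((ℕ × ℕ) × ℕ) × ℕ => ¬ w.2 = 0 :=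
      .of_primrec (PrimrecPred.not (Primrec.eq.comp Primrec.snd (Primrec.const 0)))
    refine (h0.and ((h1.and h2).exists_nat.forall_lt Primrec.snd)).of_eq fun z => ?_
    refine Iff.trans ?_ Nat.mem_rfind.symm
    simp

theorem UniformlyHaltingCE.isSigma2 {U : ℕ → Set (List Bool)} (hU : UniformlyHaltingCE U) :
    IsSigma2 fun x : ℕ × List Bool => x.2 ∈ U x.1 := by
  obtain ⟨f, hf, h⟩ := hU
  have h1 := (isSigma2_graph_of_recursiveIn hf).comp
    (((Primrec.encode (α := ℕ × List Bool)).comp Primrec.fst).pair (Primrec.snd (β := ℕ)))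
  refine h1.exists_nat.of_eq fun x => ?_
  rw [h, Part.dom_iff_mem]
  simp

/-- Membership means that a program diverges at some `a`. Each divergence is one question to `∅'`,
so an unbounded search over `a` enumerates the set. -/
theorem uniformlyHaltingCE_of_isSigma2 {U : ℕ → Set (List Bool)}
    (hU : IsSigma2 fun x : ℕ × List Bool => x.2 ∈ U x.1) : UniformlyHaltingCE U := by
  obtain ⟨c, hc⟩ := hU.exists_code
  -- `haltingSet` is diagonal, so the program with index `g m` must ignore its own input; composing
  -- with `Code.left` discards it.
  let g : ℕ → ℕ := fun m => encode ((c.comp Code.left).curry m)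
  have hg : Primrec g := Primrec.encode.comp
    (Code.primrec₂_curry.comp (Primrec.const _) Primrec.id)
  have hgm (m : ℕ) : g m ∈ haltingSet ↔ (Code.eval c m).Dom := by
    simp [g, haltingSet, Code.eval_curry, Code.eval, PFun.some_part_bind]
  let F : ℕ →. ℕ := fun n => Nat.rfind fun a =>
    (fun m => m = 0) <$> (Part.some (g (Nat.pair n a)) >>= haltingOracle)
  have hF : Nat.RecursiveIn {haltingOracle} F :=
    .rfind (.comp (.oracle haltingOracle (Set.mem_singleton _))
      (Nat.Primrec.recursiveIn (Primrec.nat_iff.1 hg)))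
  have hdec : Nat.RecursiveIn {haltingOracle} fun n =>
      ((decode (α := ℕ × List Bool) n).map encode : Part ℕ) := by
    refine Nat.Partrec.recursiveIn (Partrec.nat_iff.1 (Computable.ofOption ?_))
    exact (Primrec.option_map Primrec.decode (Primrec.encode.comp Primrec.snd).to₂).to_comp
  refine ⟨fun x => (F (encode x)).map fun _ => (), ?_, fun i σ => ?_⟩
  · refine (Nat.RecursiveIn.comp .zero (.comp hF hdec)).of_eq fun n => ?_
    cases h : decode (α := ℕ × List Bool) n with
    | none => simp [PFun.none_part_bind]
    | some x =>
      ext y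
      have hu (u : Unit) : encode u = 0 := rfl
      have : y ∈ (0 : Part ℕ) ↔ y = 0 := Part.mem_some_iff
      simp [PFun.some_part_bind, this, hu, eq_comm]
  · rw [hc (i, σ)]
    refine Iff.trans ?_ Nat.rfind_dom.symm
    simp [haltingOracle, hgm, PFun.some_part_bind]

theorem uniformlyHaltingCE_iff {U : ℕ → Set (List Bool)} :
    UniformlyHaltingCE U ↔ IsSigma2 fun x : ℕ × List Bool => x.2 ∈ U x.1 :=
  ⟨UniformlyHaltingCE.isSigma2, uniformlyHaltingCE_of_isSigma2⟩

end HaltingCE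

/-! ### Cylinders -/

section Cylinder

theorem length_initSeg (X : ℕ → Bool) (n : ℕ) : (initSeg X n).length = n := by
  simp [initSeg]

theorem take_initSeg (X : ℕ → Bool) {m n : ℕ} (h : m ≤ n) :
    (initSeg X n).take m = initSeg X m := by
  simp [initSeg, ← List.map_take, List.take_range, h]

theorem initSeg_prefix (X : ℕ → Bool) {m n : ℕ} (h : m ≤ n) : initSeg X m <+: initSeg X n :=
  take_initSeg X h ▸ List.take_prefix _ _

theorem eq_initSeg_of_prefix {X : ℕ → Bool} {n : ℕ} {σ : List Bool} (h : σ <+: initSeg X n) :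
    σ = initSeg X σ.length := by
  have hl := h.length_le
  rw [length_initSeg] at hl
  rw [← take_initSeg X hl]
  exact List.prefix_iff_eq_take.1 h

theorem initSeg_injective : Function.Injective initSeg := by
  intro X Y h
  funext n
  have h1 := congrArg (·[n]?) (congrFun h (n + 1))
  simpa [initSeg] using h1

theorem mem_openOf {S : Set (List Bool)} {X : ℕ → Bool} :
    X ∈ openOf S ↔ ∃ n, initSeg X n ∈ S := by
  simp only [openOf, cylinderSet, Set.mem_iUnion, Set.mem_ofPred_eq, exists_prop]
  constructor
  · rintro ⟨σ, hσ, h⟩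
    exact ⟨σ.length, by rwa [h]⟩
  · rintro ⟨n, hn⟩
    exact ⟨_, hn, by rw [length_initSeg]⟩

theorem cylinderSet_eq_pi (σ : List Bool) :
    cylinderSet σ = Set.pi (Finset.range σ.length) fun i => {σ.getD i false} := by
  ext X
  simp only [cylinderSet, initSeg, Set.mem_ofPred_eq, Set.mem_pi, Finset.coe_range, Set.mem_Iio,
    Set.mem_singleton_iff]
  constructor
  · intro h i hi
    have := congrArg (·.getD i false) h
    simpa [List.getD_eq_getElem?_getD, hi] using this
  · intro h
    refine List.ext_getElem (by simp) fun i h1 h2 => ?_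
    simp [h i h2, h2]

theorem isClopen_cylinderSet (σ : List Bool) : IsClopen (cylinderSet σ) := by
  rw [cylinderSet_eq_pi]
  exact ⟨isClosed_set_pi fun i _ => isClosed_discrete _,
    isOpen_set_pi (Finset.finite_toSet _) fun i _ => isOpen_discrete _⟩

theorem isOpen_openOf (S : Set (List Bool)) : IsOpen (openOf S) :=
  isOpen_biUnion fun σ _ => (isClopen_cylinderSet σ).isOpen

theorem measurableSet_cylinderSet (σ : List Bool) : MeasurableSet (cylinderSet σ) := by
  rw [cylinderSet_eq_pi]
  exact .pi (Finset.countable_toSet _) fun i _ => measurableSet_singleton _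

theorem measurableSet_openOf (S : Set (List Bool)) : MeasurableSet (openOf S) :=
  .biUnion (Set.to_countable S) fun σ _ => measurableSet_cylinderSet σ

theorem openOf_mono {S T : Set (List Bool)} (h : S ⊆ T) : openOf S ⊆ openOf T :=
  Set.biUnion_subset_biUnion_left h

theorem openOf_union (S T : Set (List Bool)) : openOf (S ∪ T) = openOf S ∪ openOf T :=
  Set.biUnion_union _ _ _

instance : IsProbabilityMeasure uniformMeasure := by
  unfold uniformMeasure; infer_instance

theorem uniformMeasure_cylinderSet (σ : List Bool) :
    uniformMeasure (cylinderSet σ) = 2⁻¹ ^ σ.length := by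
  rw [cylinderSet_eq_pi, uniformMeasure,
    Measure.infinitePi_pi _ fun i _ => measurableSet_singleton _]
  simp

theorem setOf_initSeg_eq_openOf (p : List Bool → Prop) (n : ℕ) :
    {X | p (initSeg X n)} = openOf {ξ | ξ.length = n ∧ p ξ} := by
  ext X
  rw [mem_openOf]
  constructor
  · exact fun h => ⟨n, length_initSeg X n, h⟩
  · rintro ⟨m, hm, h⟩
    obtain rfl : m = n := (length_initSeg X m).symm.trans hm
    exact h

theorem isClopen_setOf_initSeg (p : List Bool → Prop) (n : ℕ) :
    IsClopen {X | p (initSeg X n)} := by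
  constructor
  · rw [← isOpen_compl_iff]
    have : {X | p (initSeg X n)}ᶜ = {X | ¬ p (initSeg X n)} := rfl
    rw [this, setOf_initSeg_eq_openOf (fun ξ => ¬ p ξ)]
    exact isOpen_openOf _
  · rw [setOf_initSeg_eq_openOf]
    exact isOpen_openOf _

/-- The list of all strings of length `n`. -/
def allStrings : ℕ → List (List Bool)
  | 0 => [[]]
  | n + 1 => (allStrings n).map (List.cons false) ++ (allStrings n).map (List.cons true)

theorem mem_allStrings {n : ℕ} {ξ : List Bool} : ξ ∈ allStrings n ↔ ξ.length = n := by
  induction n generalizing ξ with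
  | zero => simp [allStrings]
  | succ n ih =>
    rcases ξ with _ | ⟨_ | _, ξ⟩ <;> simp [allStrings, ih]

theorem nodup_allStrings (n : ℕ) : (allStrings n).Nodup := by
  induction n with
  | zero => simp [allStrings]
  | succ n ih =>
    refine List.Nodup.append (ih.map List.cons_injective) (ih.map List.cons_injective) ?_
    simp [List.disjoint_left]

theorem primrec_allStrings : Primrec allStrings := by
  have h : Primrec (Nat.rec [[]] fun (_ : ℕ) (l : List (List Bool)) =>
      l.map (List.cons false) ++ l.map (List.cons true) : ℕ → List (List Bool)) := by
    refine Primrec.nat_rec₁ _ ?_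
    exact Primrec.list_append.comp
      (Primrec.list_map Primrec.snd (Primrec.list_cons.comp (Primrec.const _) Primrec.snd))
      (Primrec.list_map Primrec.snd (Primrec.list_cons.comp (Primrec.const _) Primrec.snd))
  refine h.of_eq fun n => ?_
  induction n with
  | zero => rfl
  | succ n ih => simp only [allStrings, ← ih]

theorem uniformMeasure_openOf_list_le {G : List (List Bool)} {L : ℕ}
    (hG : ∀ ξ ∈ G, ξ.length = L) :
    uniformMeasure (openOf {ξ | ξ ∈ G}) ≤ G.length * 2⁻¹ ^ L := by
  classical
  have h : openOf {ξ | ξ ∈ G} = ⋃ ξ ∈ G.toFinset, cylinderSet ξ := by simp [openOf]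
  rw [h]
  refine (measure_biUnion_finset_le _ _).trans ?_
  rw [Finset.sum_congr rfl fun ξ hξ => by
    rw [uniformMeasure_cylinderSet, hG ξ (List.mem_toFinset.1 hξ)]]
  rw [Finset.sum_const, nsmul_eq_mul]
  gcongr
  exact List.toFinset_card_le G

theorem disjoint_cylinderSet {ξ ξ' : List Bool} (hl : ξ.length = ξ'.length) (h : ξ ≠ ξ') :
    Disjoint (cylinderSet ξ) (cylinderSet ξ') := by
  refine Set.disjoint_left.2 fun X h1 h2 => h ?_
  rw [← show initSeg X ξ.length = ξ from h1, hl]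
  exact h2

theorem uniformMeasure_setOf_initSeg (p : List Bool → Prop) [DecidablePred p] (n : ℕ) :
    uniformMeasure {X | p (initSeg X n)} =
      ((allStrings n).filter fun ξ => p ξ).length * 2⁻¹ ^ n := by
  have h : {X | p (initSeg X n)} =
      ⋃ ξ ∈ ((allStrings n).filter fun ξ => p ξ).toFinset, cylinderSet ξ := by
    rw [setOf_initSeg_eq_openOf]
    simp [openOf, mem_allStrings]
  have hmem : ∀ ξ ∈ ((allStrings n).filter fun ξ => p ξ).toFinset, ξ.length = n := by
    simp +contextual [mem_allStrings]
  rw [h, measure_biUnion_finset]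
  · rw [Finset.sum_congr rfl fun ξ hξ => by rw [uniformMeasure_cylinderSet, hmem ξ hξ]]
    rw [Finset.sum_const, nsmul_eq_mul, List.toFinset_card_of_nodup ((nodup_allStrings n).filter _)]
  · exact fun ξ hξ ξ' hξ' hne => disjoint_cylinderSet ((hmem ξ hξ).trans (hmem ξ' hξ').symm) hne
  · exact fun ξ _ => measurableSet_cylinderSet ξ

end Cylinder

/-! ### Stagewise approximation of Turing functionals -/

section Stage

theorem PrimrecPred.prefix {α : Type*} [Primcodable α] {f g : α → List Bool} (hf : Primrec f)
    (hg : Primrec g) : PrimrecPred fun x => f x <+: g x :=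
  PrimrecPred.of_eq (Primrec.eq.comp hf (Primrec.list_take.comp (Primrec.list_length.comp hf) hg))
    fun _ => List.prefix_iff_eq_take.symm

namespace TuringFunctional

/-- `E` is a stagewise approximation of `Φ`: `E (ξ, σ)` says that `Φ` is seen, within the resources
bounded by the length of `ξ`, to map `ξ` to an extension of `σ`. -/
structure IsStage (Φ : TuringFunctional) (E : List Bool × List Bool → Prop) : Prop where
  primrec : PrimrecPred E
  mono : ∀ ⦃ξ ξ' σ⦄, ξ <+: ξ' → E (ξ, σ) → E (ξ', σ)
  extends_iff : ∀ X σ, Φ.Extends X σ ↔ ∃ n, E (initSeg X n, σ)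

/-- Bounding both the prefix of `ξ` that is used and the enumeration witness by `ξ.length` makes the
relation decidable and monotone. Nothing is lost in the limit, as the initial segments of `X` grow
without bound. -/
theorem exists_isStage (Φ : TuringFunctional) : ∃ E, Φ.IsStage E := by
  obtain ⟨q, hq, h⟩ := Φ.ce.isSigma1
  -- A number `a` codes an output string together with a witness that the pair is enumerated.
  let t : ℕ → List Bool := fun a => (Encodable.decode (α := List Bool) a.unpair.1).getD []
  have ht : Primrec t := Primrec.option_getD.comp
    (Primrec.decode.comp (Primrec.fst.comp Primrec.unpair)) (Primrec.const _)
  let r : ((List Bool × List Bool) × ℕ) × ℕ → Prop := fun w =>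
    q ((w.1.1.1.take w.1.2, t w.2), w.2.unpair.2) ∧ w.1.1.2 <+: t w.2
  have hf : Primrec fun w : ((List Bool × List Bool) × ℕ) × ℕ => w.1.1 :=
    Primrec.fst.comp Primrec.fst
  have hr : PrimrecPred r :=
    (hq.comp (((Primrec.list_take.comp (Primrec.snd.comp Primrec.fst) (Primrec.fst.comp hf)).pair
      (ht.comp Primrec.snd)).pair (Primrec.snd.comp (Primrec.unpair.comp Primrec.snd)))).and
    (.prefix (Primrec.snd.comp hf) (ht.comp Primrec.snd))
  have hl : Primrec fun z : List Bool × List Bool => z.1.length + 1 :=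
    Primrec.succ.comp (Primrec.list_length.comp Primrec.fst)
  refine ⟨fun z => z.2 = [] ∨ ∃ m < z.1.length + 1, ∃ a < z.1.length + 1, r ((z, m), a),
    ⟨?_, ?_, ?_⟩⟩
  · exact .or (Primrec.eq.comp Primrec.snd (Primrec.const []))
      ((hr.exists_lt' (hl.comp Primrec.fst)).exists_lt' hl)
  · rintro ξ ξ' σ hξ (h | ⟨m, hm, a, ha, h1, h2⟩)
    · exact .inl h
    · have hle := hξ.length_le
      refine .inr ⟨m, by simp at hm ⊢; omega, a, by simp at ha ⊢; omega, ?_, h2⟩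
      obtain ⟨ζ, rfl⟩ := hξ
      simp only at h1 hm ⊢
      rwa [List.take_append_of_le_length (by omega)]
  · intro X σ
    constructor
    · rintro (h0 | ⟨n, τ, hn, hτ⟩)
      · exact ⟨0, .inl h0⟩
      · obtain ⟨s, hs⟩ := (h _).1 hn
        let a := Nat.pair (Encodable.encode τ) s
        have hta : t a = τ := by simp [t, a]
        have ha : a.unpair.2 = s := by simp [a]
        refine ⟨n + a, .inr ⟨n, ?_, a, ?_, ?_, ?_⟩⟩
        · simp [length_initSeg]
        · simp [length_initSeg]
        · simpa only [hta, ha, take_initSeg X (Nat.le_add_right n a)] using hs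
        · simpa only [hta] using hτ
    · rintro ⟨n, h0 | ⟨m, hm, a, -, h1, h2⟩⟩
      · exact .inl h0
      · simp only [length_initSeg] at h1 hm
        rw [take_initSeg X (by omega)] at h1
        exact .inr ⟨m, t a, (h _).2 ⟨_, h1⟩, h2⟩

theorem Extends.prefix {Φ : TuringFunctional} {X : ℕ → Bool} {σ τ : List Bool}
    (h : Φ.Extends X τ) (hσ : σ <+: τ) : Φ.Extends X σ := by
  obtain rfl | ⟨n, τ', hn, hτ⟩ := h
  · exact .inl (List.prefix_nil.1 hσ)
  · exact .inr ⟨n, τ', hn, hσ.trans hτ⟩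

theorem Extends.comparable {Φ : TuringFunctional} {X : ℕ → Bool} {σ τ : List Bool}
    (hσ : Φ.Extends X σ) (hτ : Φ.Extends X τ) : σ <+: τ ∨ τ <+: σ := by
  obtain rfl | ⟨m, σ', hm, hσ'⟩ := hσ
  · exact .inl (List.nil_prefix)
  obtain rfl | ⟨n, τ', hn, hτ'⟩ := hτ
  · exact .inr (List.nil_prefix)
  rcases le_total m n with hmn | hmn
  · rcases Φ.consistent _ _ _ _ hm hn (initSeg_prefix X hmn) with h | h
    · exact List.prefix_or_prefix_of_prefix (hσ'.trans h) hτ'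
    · exact List.prefix_or_prefix_of_prefix hσ' (hτ'.trans h)
  · rcases Φ.consistent _ _ _ _ hn hm (initSeg_prefix X hmn) with h | h
    · exact List.prefix_or_prefix_of_prefix hσ' (hτ'.trans h)
    · exact List.prefix_or_prefix_of_prefix (hσ'.trans h) hτ'

/-- All outputs on one oracle are comparable, so the value chosen in `toPFun` is the only possible
one. -/
theorem mem_toPFun_iff {Φ : TuringFunctional} {X Y : ℕ → Bool} :
    Y ∈ Φ.toPFun X ↔ ∀ n, Φ.Extends X (initSeg Y n) := by
  constructor
  · rintro ⟨h, rfl⟩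
    exact h.choose_spec
  · intro hY
    have h : ∃ Y : ℕ → Bool, ∀ n, Φ.Extends X (initSeg Y n) := ⟨Y, hY⟩
    refine ⟨h, initSeg_injective (funext fun n => ?_)⟩
    have hl : (initSeg h.choose n).length = (initSeg Y n).length := by
      rw [length_initSeg, length_initSeg]
    rcases (h.choose_spec n).comparable (hY n) with hp | hp
    · exact hp.eq_of_length hl
    · exact (hp.eq_of_length hl.symm).symm

/-- The set of oracles which `Φ` maps to an extension of `σ`. -/
def preimage (Φ : TuringFunctional) (σ : List Bool) : Set (ℕ → Bool) := {X | Φ.Extends X σ}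

theorem IsStage.preimage_eq {Φ : TuringFunctional} {E : List Bool × List Bool → Prop}
    (hE : Φ.IsStage E) (σ : List Bool) : Φ.preimage σ = openOf {ξ | E (ξ, σ)} := by
  ext X
  rw [mem_openOf]
  exact hE.extends_iff X σ

theorem measurableSet_preimage (Φ : TuringFunctional) (σ : List Bool) :
    MeasurableSet (Φ.preimage σ) := by
  obtain ⟨E, hE⟩ := Φ.exists_isStage
  rw [hE.preimage_eq]
  exact measurableSet_openOf _

theorem weight_induced (Φ : TuringFunctional) (S : Set (List Bool)) :
    weight Φ.induced S = ∑' σ : S, uniformMeasure (Φ.preimage σ) := by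
  refine tsum_congr fun σ => ?_
  exact ENNReal.ofReal_toReal (measure_ne_top _ _)

theorem semimeasureTwoRandom_of_mem_toPFun {Φ : TuringFunctional} {X Y : ℕ → Bool}
    (hX : TwoRandom X) (hY : Y ∈ Φ.toPFun X) : SemimeasureTwoRandom Φ.induced Y := by
  obtain ⟨E, hE⟩ := Φ.exists_isStage
  intro U hU hw hmem
  have hop (i : ℕ) : openOf {ξ | ∃ τ, τ ∈ U i ∧ E (ξ, τ)} = ⋃ τ ∈ U i, Φ.preimage τ := by
    ext X
    simp only [hE.preimage_eq, mem_openOf, Set.mem_iUnion, Set.mem_ofPred_eq, exists_prop]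
    exact ⟨fun ⟨n, τ, h1, h2⟩ => ⟨τ, h1, n, h2⟩, fun ⟨τ, h1, n, h2⟩ => ⟨n, τ, h1, h2⟩⟩
  refine hX (fun i => {ξ | ∃ τ, τ ∈ U i ∧ E (ξ, τ)}) ?_ (fun i => ?_) ?_
  · rw [uniformlyHaltingCE_iff] at hU ⊢
    have h1 : IsSigma2 fun w : (ℕ × List Bool) × List Bool => w.2 ∈ U w.1.1 :=
      hU.comp ((Primrec.fst.comp Primrec.fst).pair Primrec.snd)
    have h2 : IsSigma2 fun w : (ℕ × List Bool) × List Bool => E (w.1.2, w.2) :=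
      .of_primrec (hE.primrec.comp ((Primrec.snd.comp Primrec.fst).pair Primrec.snd))
    exact (h1.and h2).exists_of_inhabited
  · rw [hop]
    refine (measure_biUnion_le _ (Set.to_countable _) _).trans ?_
    rw [← weight_induced]
    exact hw i
  · simp only [hop, Set.mem_iInter, Set.mem_iUnion] at hmem ⊢
    intro i
    obtain ⟨n, hn⟩ := mem_openOf.1 (hmem i)
    exact ⟨_, hn, mem_toPFun_iff.1 hY n⟩

end TuringFunctional

end Stage

/-! ### A universal test relative to the halting problem -/

section Universal

open Nat.Partrec (Code)
open Encodable

theorem Primrec.two_pow {α : Type*} [Primcodable α] {f : α → ℕ} (hf : Primrec f) :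
    Primrec fun x => 2 ^ f x :=
  (Primrec₂.unpaired'.1 Nat.Primrec.pow : Primrec₂ fun m n : ℕ => m ^ n).comp (Primrec.const 2) hf

/-- Makes bounds on measures of clopen sets decidable by counting strings. -/
theorem natCast_mul_two_inv_pow_le_iff {n i L : ℕ} :
    (n : ℝ≥0∞) * 2⁻¹ ^ L ≤ 2⁻¹ ^ i ↔ n * 2 ^ i ≤ 2 ^ L := by
  have h0 (m : ℕ) : (2 : ℝ≥0∞) ^ m ≠ 0 := by simp
  have ht (m : ℕ) : (2 : ℝ≥0∞) ^ m ≠ ⊤ := by simp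
  rw [← ENNReal.inv_pow, ← ENNReal.inv_pow, ← div_eq_mul_inv, ENNReal.div_le_iff (h0 L) (ht L),
    mul_comm, ← div_eq_mul_inv, ENNReal.le_div_iff_mul_le (.inl (h0 i)) (.inl (ht i))]
  exact_mod_cast Iff.rfl

/-- The string named by a witness `c`. -/
def witnessString (c : ℕ) : List Bool := (decode (α := List Bool) c.unpair.1).getD []

theorem primrec_witnessString : Primrec witnessString :=
  Primrec.option_getD.comp (Primrec.decode.comp (Primrec.fst.comp Primrec.unpair)) (Primrec.const _)

/-- `c` witnesses that the string it names is in the `i`-th component of the `e`-th sequence of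
sets of strings. -/
def Witness (e i c : ℕ) : Prop :=
  ¬ (Code.eval (Denumerable.ofNat Code e)
    (Nat.pair (encode (i, witnessString c)) c.unpair.2)).Dom

theorem isSigma1_not_witness : IsSigma1 fun z : (ℕ × ℕ) × ℕ => ¬ Witness z.1.1 z.1.2 z.2 := by
  have h : IsSigma1 fun z : (ℕ × ℕ) × ℕ => (Code.eval (Denumerable.ofNat Code z.1.1)
      (Nat.pair (encode (z.1.2, witnessString z.2)) z.2.unpair.2)).Dom :=
    IsSigma1.eval_dom ((Primrec.ofNat Code).comp (Primrec.fst.comp Primrec.fst))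
      (Primrec₂.natPair.comp (Primrec.encode.comp ((Primrec.snd.comp Primrec.fst).pair
        (primrec_witnessString.comp Primrec.snd))) (Primrec.snd.comp
          (Primrec.unpair.comp Primrec.snd)))
  obtain ⟨q, hq, h⟩ := h
  exact ⟨q, hq, fun z => not_not.trans (h z)⟩

theorem isSigma2_witness : IsSigma2 fun z : (ℕ × ℕ) × ℕ => Witness z.1.1 z.1.2 z.2 :=
  (IsSigma2.not_of_sigma1 isSigma1_not_witness).of_eq fun _ => not_not

/-- The strings named by the witnesses below `N` are covered by the strings in `z.1`, all of which
have length `z.2`, and of which there are at most `2 ^ z.2 / 2 ^ i`. -/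
def IsSmallCover (e i N : ℕ) (z : List (List Bool) × ℕ) : Prop :=
  (z.1.length * 2 ^ i ≤ 2 ^ z.2 ∧ ∀ ξ ∈ z.1, ξ.length = z.2) ∧
    ∀ c < N, ¬ Witness e i c ∨ ((witnessString c).length ≤ z.2 ∧
      ∀ ξ ∈ allStrings z.2, ¬ witnessString c <+: ξ ∨ ∃ ζ ∈ z.1, ζ = ξ)

/-- `Witness` is `Π₁` and occurs only negated, under a bounded quantifier. -/
theorem isSigma2_isSmallCover :
    IsSigma2 fun w : ((ℕ × ℕ) × ℕ) × (List (List Bool) × ℕ) =>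
      IsSmallCover w.1.1.1 w.1.1.2 w.1.2 w.2 := by
  have s {α β : Type} [Primcodable α] [Primcodable β] : Primrec (Prod.snd : α × β → β) := .snd
  have f {α β : Type} [Primcodable α] [Primcodable β] : Primrec (Prod.fst : α × β → α) := .fst
  refine .and (.of_primrec (.and ?_ ?_)) ?_
  · exact Primrec.nat_le.comp (Primrec.nat_mul.comp (Primrec.list_length.comp (f.comp s))
      (Primrec.two_pow (s.comp (f.comp f)))) (Primrec.two_pow (s.comp s))
  · have h : PrimrecPred fun v : (((ℕ × ℕ) × ℕ) × (List (List Bool) × ℕ)) × List Bool =>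
        v.2.length = v.1.2.2 :=
      Primrec.eq.comp (Primrec.list_length.comp s) (s.comp (s.comp f))
    exact h.forall_mem (f.comp s)
  · have h1 : IsSigma2 fun v : (((ℕ × ℕ) × ℕ) × (List (List Bool) × ℕ)) × ℕ =>
        ¬ Witness v.1.1.1.1 v.1.1.1.2 v.2 :=
      .of_sigma1 (isSigma1_not_witness.comp ((f.comp (f.comp f)).pair s))
    have h2 : PrimrecPred fun v : (((ℕ × ℕ) × ℕ) × (List (List Bool) × ℕ)) × ℕ =>
        (witnessString v.2).length ≤ v.1.2.2 :=
      Primrec.nat_le.comp (Primrec.list_length.comp (primrec_witnessString.comp s))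
        (s.comp (s.comp f))
    have h3 : PrimrecPred
        fun u : ((((ℕ × ℕ) × ℕ) × (List (List Bool) × ℕ)) × ℕ) × List Bool =>
          ¬ witnessString u.1.2 <+: u.2 :=
      .not (.prefix (primrec_witnessString.comp (s.comp f)) s)
    have h4 : PrimrecPred
        fun u : (((((ℕ × ℕ) × ℕ) × (List (List Bool) × ℕ)) × ℕ) × List Bool) × List Bool =>
          u.2 = u.1.2 := Primrec.eq.comp s (s.comp f)
    have h5 := h3.or (h4.exists_mem (f.comp (s.comp (f.comp f))))
    have h6 := h2.and (h5.forall_mem (primrec_allStrings.comp (s.comp (s.comp f))))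
    exact (h1.or (.of_primrec h6)).forall_lt (s.comp f)

/-- The `i`-th component of the `e`-th sequence of sets of strings, cut off before its measure
exceeds `2 ^ (-i)`. -/
def trimmed (e i : ℕ) : Set (List Bool) :=
  ⋃ N, {σ | (∃ c < N, Witness e i c ∧ witnessString c = σ) ∧ ∃ z, IsSmallCover e i N z}

theorem isSigma2_trimmed : IsSigma2 fun w : (ℕ × ℕ) × List Bool => w.2 ∈ trimmed w.1.1 w.1.2 := by
  have s {α β : Type} [Primcodable α] [Primcodable β] : Primrec (Prod.snd : α × β → β) := .snd
  have f {α β : Type} [Primcodable α] [Primcodable β] : Primrec (Prod.fst : α × β → α) := .fst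
  have h1 : IsSigma2 fun v : (((ℕ × ℕ) × List Bool) × ℕ) × ℕ => Witness v.1.1.1.1 v.1.1.1.2 v.2 :=
    isSigma2_witness.comp ((f.comp (f.comp f)).pair s)
  have h2 : PrimrecPred fun v : (((ℕ × ℕ) × List Bool) × ℕ) × ℕ =>
      witnessString v.2 = v.1.1.2 :=
    Primrec.eq.comp (primrec_witnessString.comp s) (s.comp (f.comp f))
  have h3 : IsSigma2 fun v : ((ℕ × ℕ) × List Bool) × ℕ =>
      ∃ z, IsSmallCover v.1.1.1 v.1.1.2 v.2 z :=
    isSigma2_isSmallCover.exists_of_inhabited.comp ((f.comp f).pair s)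
  refine (((h1.and (.of_primrec h2)).exists_lt s).and h3).exists_nat.of_eq fun w => ?_
  simp only [trimmed, Set.mem_iUnion, Set.mem_ofPred_eq]

theorem openOf_iUnion {ι : Sort*} (S : ι → Set (List Bool)) :
    openOf (⋃ i, S i) = ⋃ i, openOf (S i) := by
  ext X
  simp only [mem_openOf, Set.mem_iUnion]
  exact exists_comm

/-- Each stage is either empty or inside a cover of measure at most `2⁻ⁱ`. The stages are directed
though not monotone: for `N ≤ M`, stage `M` either has a cover and contains stage `N`, or is empty.
-/
theorem uniformMeasure_trimmed_le (e i : ℕ) :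
    uniformMeasure (openOf (trimmed e i)) ≤ 2⁻¹ ^ i := by
  rw [trimmed, openOf_iUnion, Directed.measure_iUnion]
  · refine iSup_le fun N => ?_
    by_cases h : ∃ z, IsSmallCover e i N z
    · obtain ⟨z, ⟨hz, hl⟩, hc⟩ := id h
      refine le_trans (measure_mono ?_) ((uniformMeasure_openOf_list_le hl).trans
        (natCast_mul_two_inv_pow_le_iff.2 hz))
      intro X hX
      obtain ⟨n, ⟨c, hcN, hw, hcn⟩, -⟩ := mem_openOf.1 hX
      obtain ⟨hle, hcov⟩ := (hc c hcN).resolve_left (not_not.2 hw)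
      rw [hcn, length_initSeg] at hle
      obtain ⟨ζ, hζ, rfl⟩ := (hcov (initSeg X z.2)
        (mem_allStrings.2 (length_initSeg _ _))).resolve_left (not_not.2 (hcn ▸ initSeg_prefix X hle))
      exact mem_openOf.2 ⟨_, hζ⟩
    · simp [h, openOf]
  · have key (N M : ℕ) (h : N ≤ M) : ∃ K,
        openOf {σ | (∃ c < N, Witness e i c ∧ witnessString c = σ) ∧ ∃ z, IsSmallCover e i N z} ⊆
          openOf {σ | (∃ c < K, Witness e i c ∧ witnessString c = σ) ∧ ∃ z, IsSmallCover e i K z} ∧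
        openOf {σ | (∃ c < M, Witness e i c ∧ witnessString c = σ) ∧ ∃ z, IsSmallCover e i M z} ⊆
          openOf {σ | (∃ c < K, Witness e i c ∧ witnessString c = σ) ∧
            ∃ z, IsSmallCover e i K z} := by
      by_cases hM : ∃ z, IsSmallCover e i M z
      · exact ⟨M, openOf_mono fun σ ⟨⟨c, hc, hw⟩, _⟩ => ⟨⟨c, hc.trans_le h, hw⟩, hM⟩, subset_rfl⟩
      · exact ⟨N, subset_rfl, openOf_mono fun σ hσ => absurd hσ.2 hM⟩
    intro N M
    rcases le_total N M with h | h
    · exact key N M h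
    · exact (key M N h).imp fun _ => And.symm

/-- Nothing is cut from a genuine test: the extensions, of one large length, of finitely many of its
strings form a small enough cover. -/
theorem trimmed_eq {U : ℕ → Set (List Bool)} {c : Code}
    (hc : ∀ i σ, σ ∈ U i ↔ ∃ a, ¬ (Code.eval c (Nat.pair (encode (i, σ)) a)).Dom)
    (hU : ∀ i, uniformMeasure (openOf (U i)) ≤ 2⁻¹ ^ i) (i : ℕ) :
    trimmed (encode c) i = U i := by
  classical
  have hmem {d : ℕ} (hd : Witness (encode c) i d) : witnessString d ∈ U i := by
    rw [hc]
    exact ⟨_, by simpa [Witness] using hd⟩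
  ext σ
  simp only [trimmed, Set.mem_iUnion, Set.mem_ofPred_eq]
  constructor
  · rintro ⟨N, ⟨d, -, hd, rfl⟩, -⟩
    exact hmem hd
  · intro hσ
    obtain ⟨a, ha⟩ := (hc i σ).1 hσ
    let d := Nat.pair (encode σ) a
    have hd : witnessString d = σ := by simp [d, witnessString]
    refine ⟨d + 1, ⟨d, by omega, ?_, hd⟩, ?_⟩
    · simpa [Witness, hd] using show ¬ (Code.eval c (Nat.pair (encode (i, σ)) d.unpair.2)).Dom by
        simpa [d] using ha
    -- The sum is merely a convenient common bound on the lengths.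
    let L := ((List.range (d + 1)).map fun c => (witnessString c).length).sum
    have hL : ∀ b < d + 1, (witnessString b).length ≤ L := fun b hb =>
      List.single_le_sum (by simp) _ (List.mem_map_of_mem (List.mem_range.2 hb))
    let p : List Bool → Prop := fun ξ =>
      ∃ b < d + 1, Witness (encode c) i b ∧ witnessString b <+: ξ
    refine ⟨((allStrings L).filter fun ξ => p ξ, L), ⟨?_, ?_⟩, fun b hb => ?_⟩
    · rw [← natCast_mul_two_inv_pow_le_iff]
      rw [← uniformMeasure_setOf_initSeg]
      refine (measure_mono ?_).trans (hU i)
      rintro X ⟨b, -, hb, hp⟩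
      exact mem_openOf.2 ⟨_, eq_initSeg_of_prefix hp ▸ hmem hb⟩
    · simp +contextual [mem_allStrings]
    · by_cases hw : Witness (encode c) i b
      · refine .inr ⟨hL b hb, fun ξ hξ => ?_⟩
        by_cases hp : witnessString b <+: ξ
        · exact .inr ⟨ξ, by simpa [hξ] using show p ξ from ⟨b, hb, hw, hp⟩, rfl⟩
        · exact .inl hp
      · exact .inl hw

/-- The `e`-th test contributes its component of index `k + e + 1`, and `∑ₑ 2^-(k+e+1) = 2⁻ᵏ`. Hence
avoiding a single `A k` already defeats every test. -/
theorem exists_universal_test : ∃ A : ℕ → Set (List Bool),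
    IsSigma2 (fun x : ℕ × List Bool => x.2 ∈ A x.1) ∧
    (∀ k, uniformMeasure (openOf (A k)) ≤ 2⁻¹ ^ k) ∧
    ∀ k X, X ∉ openOf (A k) → TwoRandom X := by
  refine ⟨fun k => ⋃ e, trimmed e (k + e + 1), ?_, fun k => ?_, fun k X hX U hU hm hmem => ?_⟩
  · have h : IsSigma2 fun w : (ℕ × List Bool) × ℕ => w.1.2 ∈ trimmed w.2 (w.1.1 + w.2 + 1) :=
      isSigma2_trimmed.comp ((Primrec.snd.pair (Primrec.succ.comp (Primrec.nat_add.comp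
        (Primrec.fst.comp Primrec.fst) Primrec.snd))).pair (Primrec.snd.comp Primrec.fst))
    exact h.exists_nat.of_eq fun x => by simp only [Set.mem_iUnion]
  · rw [openOf_iUnion]
    refine (measure_iUnion_le _).trans ((ENNReal.tsum_le_tsum fun e =>
      uniformMeasure_trimmed_le e _).trans ?_)
    simp_rw [add_assoc, pow_add _ k]
    rw [ENNReal.tsum_mul_left, ENNReal.tsum_geometric_add_one]
    simp [ENNReal.one_sub_inv_two, ENNReal.inv_mul_cancel]
  · obtain ⟨c, hc⟩ := (uniformlyHaltingCE_iff.1 hU).exists_code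
    refine hX ?_
    rw [openOf_iUnion, Set.mem_iUnion]
    refine ⟨encode c, ?_⟩
    rw [trimmed_eq (fun i σ => hc (i, σ)) hm]
    exact Set.mem_iInter.1 hmem _

end Universal

/-! ### Preimages up to a small error -/

section Approximation

open Encodable

variable {Φ : TuringFunctional} {E : List Bool × List Bool → Prop}

/-- The oracles which are mapped to an extension of `σ` by stage `s`. -/
def stageSet (E : List Bool × List Bool → Prop) (σ : List Bool) (s : ℕ) : Set (ℕ → Bool) :=
  {X | E (initSeg X s, σ)}

/-- Stage `s` exhausts the preimage of `σ` up to measure `2 ^ (-(k + encode σ + 1))`. -/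
def IsGoodStage (E : List Bool × List Bool → Prop) (k : ℕ) (σ : List Bool) (s : ℕ) : Prop :=
  ∀ t, uniformMeasure (stageSet E σ t \ stageSet E σ s) ≤ 2⁻¹ ^ (k + encode σ + 1)

namespace TuringFunctional.IsStage

theorem stageSet_mono (hE : Φ.IsStage E) (σ : List Bool) : Monotone (stageSet E σ) :=
  fun _ _ h X hX => hE.mono (initSeg_prefix X h) hX

theorem preimage_eq_iUnion (hE : Φ.IsStage E) (σ : List Bool) :
    Φ.preimage σ = ⋃ s, stageSet E σ s := by
  ext X
  rw [Set.mem_iUnion]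
  exact hE.extends_iff X σ

theorem exists_isGoodStage (hE : Φ.IsStage E) (k : ℕ) (σ : List Bool) :
    ∃ s, IsGoodStage E k σ s := by
  have hanti : Antitone fun s => Φ.preimage σ \ stageSet E σ s := fun s t h =>
    Set.sdiff_subset_sdiff_right (hE.stageSet_mono σ h)
  have hmeas (s : ℕ) : MeasurableSet (Φ.preimage σ \ stageSet E σ s) := by
    refine (Φ.measurableSet_preimage σ).diff ?_
    rw [stageSet, setOf_initSeg_eq_openOf fun ξ => E (ξ, σ)]
    exact measurableSet_openOf _
  have h := tendsto_measure_iInter_atTop (μ := uniformMeasure)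
    (fun s => (hmeas s).nullMeasurableSet) hanti ⟨0, measure_ne_top _ _⟩
  have h0 : ⋂ s, (Φ.preimage σ \ stageSet E σ s) = ∅ := by
    rw [← Set.sdiff_iUnion, ← hE.preimage_eq_iUnion, Set.sdiff_self]
  rw [h0, measure_empty] at h
  have hpos : (0 : ℝ≥0∞) < 2⁻¹ ^ (k + encode σ + 1) := ENNReal.pow_pos (by simp) _
  obtain ⟨s, hs⟩ := (h.eventually_lt_const hpos).exists
  refine ⟨s, fun t => (measure_mono ?_).trans hs.le⟩
  rw [hE.preimage_eq_iUnion]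
  exact Set.sdiff_subset_sdiff_left (Set.subset_iUnion _ t)

/-- Goodness is `Π₁`: for each `t` one counts strings of length `t`. When `t < s` the difference is
empty by monotonicity. -/
theorem isSigma2_isGoodStage (hE : Φ.IsStage E) :
    IsSigma2 fun z : (ℕ × List Bool) × ℕ => IsGoodStage E z.1.1 z.1.2 z.2 := by
  classical
  have s {α β : Type} [Primcodable α] [Primcodable β] : Primrec (Prod.snd : α × β → β) := .snd
  have f {α β : Type} [Primcodable α] [Primcodable β] : Primrec (Prod.fst : α × β → α) := .fst
  let p : ((ℕ × List Bool) × ℕ) × ℕ → List Bool → Prop := fun z ξ =>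
    E (ξ, z.1.1.2) ∧ ¬ E (ξ.take z.1.2, z.1.1.2)
  have hp : PrimrecRel fun ξ (z : ((ℕ × List Bool) × ℕ) × ℕ) => p z ξ :=
    (hE.primrec.comp (f.pair (s.comp (f.comp (f.comp s))))).and (.not (hE.primrec.comp
      ((Primrec.list_take.comp (s.comp (f.comp s)) f).pair (s.comp (f.comp (f.comp s))))))
  have hc : PrimrecPred fun z : ((ℕ × List Bool) × ℕ) × ℕ => z.2 < z.1.2 ∨
      ((allStrings z.2).filter fun ξ => p z ξ).length * 2 ^ (z.1.1.1 + encode z.1.1.2 + 1)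
        ≤ 2 ^ z.2 := by
    refine .or (Primrec.nat_lt.comp s (s.comp f)) (Primrec.nat_le.comp (Primrec.nat_mul.comp
      (Primrec.list_length.comp (hp.listFilter.comp (primrec_allStrings.comp s) .id))
      (Primrec.two_pow ?_)) (Primrec.two_pow s))
    exact Primrec.succ.comp (Primrec.nat_add.comp (f.comp (f.comp f))
      (Primrec.encode.comp (s.comp (f.comp f))))
  refine (IsSigma2.of_forall hc).of_eq fun z => forall_congr' fun t => ?_
  rcases lt_or_ge t z.2 with ht | ht
  · simp only [ht, true_or, true_iff]
    rw [Set.sdiff_eq_empty.2 (hE.stageSet_mono z.1.2 ht.le)]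
    simp
  · simp only [ht.not_gt, false_or]
    rw [← natCast_mul_two_inv_pow_le_iff, ← uniformMeasure_setOf_initSeg]
    have : {X | p (z, t) (initSeg X t)} = stageSet E z.1.2 t \ stageSet E z.1.2 z.2 := by
      ext X
      simp [p, stageSet, take_initSeg X ht]
    rw [this]

end TuringFunctional.IsStage

/-- The oracles which are mapped to an extension of some `σ`, but only after a good stage. -/
def lateSet (E : List Bool × List Bool → Prop) (k : ℕ) : Set (List Bool) :=
  {ξ | ∃ σ s, IsGoodStage E k σ s ∧ s ≤ ξ.length ∧ E (ξ, σ) ∧ ¬ E (ξ.take s, σ)}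

namespace TuringFunctional.IsStage

theorem isSigma2_lateSet (hE : Φ.IsStage E) :
    IsSigma2 fun x : ℕ × List Bool => x.2 ∈ lateSet E x.1 := by
  have s {α β : Type} [Primcodable α] [Primcodable β] : Primrec (Prod.snd : α × β → β) := .snd
  have f {α β : Type} [Primcodable α] [Primcodable β] : Primrec (Prod.fst : α × β → α) := .fst
  have h1 : IsSigma2 fun w : ((ℕ × List Bool) × List Bool) × ℕ =>
      IsGoodStage E w.1.1.1 w.1.2 w.2 :=
    hE.isSigma2_isGoodStage.comp (((f.comp (f.comp f)).pair (s.comp f)).pair s)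
  have h2 : PrimrecPred fun w : ((ℕ × List Bool) × List Bool) × ℕ => w.2 ≤ w.1.1.2.length ∧
      E (w.1.1.2, w.1.2) ∧ ¬ E (w.1.1.2.take w.2, w.1.2) :=
    .and (Primrec.nat_le.comp s (Primrec.list_length.comp (s.comp (f.comp f))))
      (.and (hE.primrec.comp ((s.comp (f.comp f)).pair (s.comp f)))
        (.not (hE.primrec.comp ((Primrec.list_take.comp s (s.comp (f.comp f))).pair (s.comp f)))))
  exact (h1.and (.of_primrec h2)).exists_nat.exists_of_inhabited

theorem openOf_lateSet (hE : Φ.IsStage E) (k : ℕ) : openOf (lateSet E k) =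
    ⋃ σ, ⋃ t, ⋃ s ∈ {s | IsGoodStage E k σ s}, stageSet E σ t \ stageSet E σ s := by
  ext X
  simp only [mem_openOf, lateSet, Set.mem_iUnion, Set.mem_ofPred_eq, Set.mem_sdiff, stageSet,
    exists_prop, length_initSeg]
  constructor
  · rintro ⟨t, σ, s, hs, hst, h1, h2⟩
    exact ⟨σ, t, s, hs, h1, by rwa [take_initSeg X hst] at h2⟩
  · rintro ⟨σ, t, s, hs, h1, h2⟩
    have hst : s ≤ t := by
      by_contra! h
      exact h2 (hE.mono (initSeg_prefix X h.le) h1)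
    exact ⟨t, σ, s, hs, hst, h1, by rwa [take_initSeg X hst]⟩

theorem preimage_sdiff_subset_openOf_lateSet (hE : Φ.IsStage E) {k s : ℕ} {σ : List Bool}
    (hs : IsGoodStage E k σ s) : Φ.preimage σ \ stageSet E σ s ⊆ openOf (lateSet E k) := by
  rw [hE.openOf_lateSet, hE.preimage_eq_iUnion, Set.iUnion_sdiff]
  refine Set.iUnion_subset fun t => ?_
  exact Set.subset_iUnion_of_subset σ (Set.subset_iUnion_of_subset t
    (Set.subset_biUnion_of_mem (u := fun s => stageSet E σ t \ stageSet E σ s) hs))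

/-- `lateSet` allows every good stage, which keeps it `Σ₂`. For the measure only the least one
counts, since later stages leave smaller differences; the errors are summed over the distinct codes
of the `σ`. -/
theorem uniformMeasure_lateSet_le (hE : Φ.IsStage E) (k : ℕ) :
    uniformMeasure (openOf (lateSet E k)) ≤ 2⁻¹ ^ k := by
  have hsub : openOf (lateSet E k) ⊆
      ⋃ σ, ⋃ t, stageSet E σ t \ stageSet E σ (sInf {s | IsGoodStage E k σ s}) := by
    rw [hE.openOf_lateSet]
    gcongr with σ t
    exact Set.iUnion₂_subset fun s hs =>
      Set.sdiff_subset_sdiff_right (hE.stageSet_mono σ (Nat.sInf_le hs))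
  refine (measure_mono hsub).trans ((measure_iUnion_le _).trans ?_)
  have hσ (σ : List Bool) :
      uniformMeasure (⋃ t, stageSet E σ t \ stageSet E σ (sInf {s | IsGoodStage E k σ s})) ≤
        2⁻¹ ^ k * 2⁻¹ ^ (encode σ + 1) := by
    rw [Monotone.measure_iUnion fun s t h => Set.sdiff_subset_sdiff_left (hE.stageSet_mono σ h)]
    rw [← pow_add, ← add_assoc]
    exact iSup_le (Nat.sInf_mem (hE.exists_isGoodStage k σ))
  refine (ENNReal.tsum_le_tsum hσ).trans ?_
  rw [ENNReal.tsum_mul_left]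
  refine (mul_le_mul_right (ENNReal.tsum_comp_le_tsum_of_injective encode_injective
    fun n => (2⁻¹ : ℝ≥0∞) ^ (n + 1)) _).trans ?_
  rw [ENNReal.tsum_geometric_add_one]
  simp [ENNReal.one_sub_inv_two, ENNReal.inv_mul_cancel]

end TuringFunctional.IsStage

/-! ### Prefix-free sets of generators -/

/-- Enumeration is delayed: `R (k, τ)` asks for a prefix of `τ` in `V k` with outer witness at most
`τ.length`. Both `R` and its negation are then `Σ₂`, and `R` persists under extension, so its
minimal strings form the required set. -/
theorem IsSigma2.exists_prefixFree {V : ℕ → Set (List Bool)}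
    (hV : IsSigma2 fun x : ℕ × List Bool => x.2 ∈ V x.1) :
    ∃ V' : ℕ → Set (List Bool), IsSigma2 (fun x : ℕ × List Bool => x.2 ∈ V' x.1) ∧
      ∀ k, openOf (V k) ⊆ openOf (V' k) ∧ (∀ τ ∈ V' k, ∃ σ ∈ V k, σ <+: τ) ∧
        ∀ τ ∈ V' k, ∀ τ' ∈ V' k, τ <+: τ' → τ = τ' := by
  obtain ⟨q, hq, h⟩ := hV
  have s {α β : Type} [Primcodable α] [Primcodable β] : Primrec (Prod.snd : α × β → β) := .snd
  have f {α β : Type} [Primcodable α] [Primcodable β] : Primrec (Prod.fst : α × β → α) := .fst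
  let R : ℕ × List Bool → Prop := fun x =>
    ∃ n < x.2.length + 1, ∃ a < x.2.length + 1, ∀ b, q (((x.1, x.2.take n), a), b)
  let q' : (((ℕ × List Bool) × ℕ) × ℕ) × ℕ → Prop := fun v =>
    q (((v.1.1.1.1, v.1.1.1.2.take v.1.1.2), v.1.2), v.2)
  have hq' : PrimrecPred q' := hq.comp ((((f.comp (f.comp (f.comp f))).pair
    (Primrec.list_take.comp (s.comp (f.comp f)) (s.comp (f.comp (f.comp f))))).pair
      (s.comp f)).pair s)
  have hl {β : Type} [Primcodable β] : Primrec fun w : (ℕ × List Bool) × β => w.1.2.length + 1 :=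
    Primrec.succ.comp (Primrec.list_length.comp (s.comp f))
  have hl' : Primrec fun x : ℕ × List Bool => x.2.length + 1 :=
    Primrec.succ.comp (Primrec.list_length.comp s)
  have hR : IsSigma2 R := ((IsSigma2.of_forall hq').exists_lt hl).exists_lt hl'
  have hnR : IsSigma2 fun x => ¬ R x := by
    have h1 : IsSigma2 fun w => ∃ b, ¬ q' (w, b) := .of_sigma1 ⟨_, hq'.not, fun _ => Iff.rfl⟩
    exact ((h1.forall_lt hl).forall_lt hl').of_eq fun x => by simp [R, q']
  have hmono {k : ℕ} {τ τ' : List Bool} (hτ : τ <+: τ') (hr : R (k, τ)) : R (k, τ') := by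
    obtain ⟨n, hn, a, ha, hb⟩ := hr
    have hle := hτ.length_le
    simp only at hn ha hb
    refine ⟨n, by simp only; omega, a, by simp only; omega, ?_⟩
    obtain ⟨ζ, rfl⟩ := hτ
    simp only
    rwa [List.take_append_of_le_length (by omega)]
  refine ⟨fun k => {τ | R (k, τ) ∧ ∀ n < τ.length, ¬ R (k, τ.take n)}, ?_, fun k => ⟨?_, ?_, ?_⟩⟩
  · have h2 : IsSigma2 fun w : (ℕ × List Bool) × ℕ => ¬ R (w.1.1, w.1.2.take w.2) :=
      hnR.comp ((f.comp f).pair (Primrec.list_take.comp s (s.comp f)))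
    exact hR.and (h2.forall_lt (Primrec.list_length.comp s))
  · classical
    intro X hX
    obtain ⟨n, hn⟩ := mem_openOf.1 hX
    obtain ⟨a, ha⟩ := (h (k, initSeg X n)).1 hn
    have hex : ∃ m, R (k, initSeg X m) := by
      refine ⟨n + a, n, ?_, a, ?_, ?_⟩
      · simp [length_initSeg]
      · simp [length_initSeg]
      · simpa only [take_initSeg X (Nat.le_add_right n a)] using ha
    refine mem_openOf.2 ⟨Nat.find hex, Nat.find_spec hex, fun m hm => ?_⟩
    rw [length_initSeg] at hm
    rw [take_initSeg X hm.le]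
    exact Nat.find_min hex hm
  · rintro τ ⟨⟨n, -, a, -, hb⟩, -⟩
    exact ⟨τ.take n, (h (k, _)).2 ⟨a, hb⟩, List.take_prefix _ _⟩
  · rintro τ hτ τ' hτ' hp
    refine hp.eq_of_length (hp.length_le.antisymm (not_lt.1 fun hlt => hτ'.2 _ hlt ?_))
    rw [← List.prefix_iff_eq_take.1 hp]
    exact hτ.1

end Approximation

/-! ### Random elements in the fibres of a Turing functional -/

section Fibre

variable {Φ : TuringFunctional} {E : List Bool × List Bool → Prop}

theorem isClosed_stageSet (E : List Bool × List Bool → Prop) (σ : List Bool) (s : ℕ) :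
    IsClosed (stageSet E σ s) :=
  (isClopen_setOf_initSeg (fun ξ => E (ξ, σ)) s).isClosed

theorem IsCompact.exists_initSeg_mem {K : Set (ℕ → Bool)} (hK : IsCompact K)
    {A : Set (List Bool)} (h : K ⊆ openOf A) (s : ℕ) :
    ∃ L, s ≤ L ∧ ∀ X ∈ K, ∃ n < L + 1, initSeg X n ∈ A := by
  have ho (L : ℕ) : IsOpen (openOf {ξ | ξ.length < L + 1 ∧ ξ ∈ A}) := isOpen_openOf _
  have hmono : Monotone fun L : ℕ => openOf {ξ | ξ.length < L + 1 ∧ ξ ∈ A} :=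
    fun L M hLM => openOf_mono fun ξ hξ => ⟨by have := hξ.1; omega, hξ.2⟩
  obtain ⟨L, hL⟩ := hK.elim_directed_cover _ ho (fun X hX => by
    obtain ⟨n, hn⟩ := mem_openOf.1 (h hX)
    exact Set.mem_iUnion.2 ⟨n, mem_openOf.2 ⟨n, by simp [length_initSeg], hn⟩⟩)
    hmono.directed_le
  refine ⟨max s L, le_max_left _ _, fun X hX => ?_⟩
  obtain ⟨n, hn, hA⟩ := mem_openOf.1 (hL hX)
  rw [length_initSeg] at hn
  exact ⟨n, by omega, hA⟩

namespace TuringFunctional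

/-- What enters the preimage after a good stage lies in `openOf A` already. Only a clopen set
remains to be covered, and by compactness finitely many strings do so. -/
theorem IsStage.preimage_subset_openOf_iff (hE : Φ.IsStage E) {k : ℕ} {A : Set (List Bool)}
    (hA : lateSet E k ⊆ A) (σ : List Bool) : Φ.preimage σ ⊆ openOf A ↔
      ∃ s, IsGoodStage E k σ s ∧ ∃ L, s ≤ L ∧
        ∀ ξ ∈ allStrings L, ¬ E (ξ.take s, σ) ∨ ∃ n < L + 1, ξ.take n ∈ A := by
  constructor
  · intro h
    obtain ⟨s, hs⟩ := hE.exists_isGoodStage k σ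
    have hsub : stageSet E σ s ⊆ openOf A := by
      refine Set.Subset.trans ?_ h
      rw [hE.preimage_eq_iUnion]
      exact Set.subset_iUnion _ s
    obtain ⟨L, hsL, hL⟩ := (isClosed_stageSet E σ s).isCompact.exists_initSeg_mem hsub s
    refine ⟨s, hs, L, hsL, fun ξ hξ => or_iff_not_imp_left.2 fun hEξ => ?_⟩
    -- Padding `ξ` with `false` gives a point of Cantor space to which the cover applies.
    have hX : initSeg (fun i => ξ.getD i false) L = ξ := by
      have : (fun i => ξ.getD i false) ∈ cylinderSet ξ := by
        rw [cylinderSet_eq_pi]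
        exact fun i _ => rfl
      rwa [cylinderSet, mem_allStrings.1 hξ] at this
    obtain ⟨n, hn, hnA⟩ := hL (fun i => ξ.getD i false) (by
      show E (_, σ)
      rw [← take_initSeg _ hsL, hX]
      exact not_not.1 hEξ)
    refine ⟨n, hn, ?_⟩
    rwa [← hX, take_initSeg _ (Nat.lt_succ_iff.1 hn)]
  · rintro ⟨s, hs, L, hsL, hL⟩ X hX
    by_cases hXs : X ∈ stageSet E σ s
    · obtain ⟨n, hn, hA⟩ := (hL (initSeg X L) (mem_allStrings.2 (length_initSeg X L))).resolve_left
        (by rw [take_initSeg X hsL]; exact not_not.2 hXs)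
      rw [take_initSeg X (Nat.lt_succ_iff.1 hn)] at hA
      exact mem_openOf.2 ⟨n, hA⟩
    · exact openOf_mono hA (hE.preimage_sdiff_subset_openOf_lateSet hs ⟨hX, hXs⟩)

theorem IsStage.isSigma2_preimage_subset (hE : Φ.IsStage E) {A : ℕ → Set (List Bool)}
    (hA : IsSigma2 fun x : ℕ × List Bool => x.2 ∈ A x.1) (hlate : ∀ k, lateSet E (k + 1) ⊆ A k) :
    IsSigma2 fun x : ℕ × List Bool => Φ.preimage x.2 ⊆ openOf (A x.1) := by
  have s {α β : Type} [Primcodable α] [Primcodable β] : Primrec (Prod.snd : α × β → β) := .snd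
  have f {α β : Type} [Primcodable α] [Primcodable β] : Primrec (Prod.fst : α × β → α) := .fst
  have h1 : IsSigma2 fun w : (ℕ × List Bool) × ℕ => IsGoodStage E (w.1.1 + 1) w.1.2 w.2 :=
    hE.isSigma2_isGoodStage.comp (((Primrec.succ.comp (f.comp f)).pair (s.comp f)).pair s)
  have h2 : PrimrecPred fun w : ((ℕ × List Bool) × ℕ) × ℕ => w.1.2 ≤ w.2 :=
    Primrec.nat_le.comp (s.comp f) s
  have h3 : PrimrecPred fun u : (((ℕ × List Bool) × ℕ) × ℕ) × List Bool =>
      ¬ E (u.2.take u.1.1.2, u.1.1.1.2) :=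
    .not (hE.primrec.comp ((Primrec.list_take.comp (s.comp (f.comp f)) s).pair
      (s.comp (f.comp (f.comp f)))))
  have h4 : IsSigma2 fun v : ((((ℕ × List Bool) × ℕ) × ℕ) × List Bool) × ℕ =>
      v.1.2.take v.2 ∈ A v.1.1.1.1.1 :=
    hA.comp ((f.comp (f.comp (f.comp (f.comp f)))).pair (Primrec.list_take.comp s (s.comp f)))
  have h5 : IsSigma2 fun u : (((ℕ × List Bool) × ℕ) × ℕ) × List Bool =>
      ¬ E (u.2.take u.1.1.2, u.1.1.1.2) ∨ ∃ n < u.1.2 + 1, u.2.take n ∈ A u.1.1.1.1 :=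
    (IsSigma2.of_primrec h3).or (h4.exists_lt (Primrec.succ.comp (s.comp f)))
  exact (h1.and ((IsSigma2.of_primrec h2).and
    (h5.forall_mem (primrec_allStrings.comp s))).exists_nat).exists_nat.of_eq fun x =>
      (hE.preimage_subset_openOf_iff (hlate x.1) x.2).symm

/-- Incomparable strings have disjoint preimages, so here the weight is exactly the measure of the
union. -/
theorem weight_induced_le {S : Set (List Bool)} (hS : ∀ τ ∈ S, ∀ τ' ∈ S, τ <+: τ' → τ = τ')
    {A : Set (ℕ → Bool)} (hA : ∀ τ ∈ S, Φ.preimage τ ⊆ A) :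
    weight Φ.induced S ≤ uniformMeasure A := by
  rw [weight_induced, ← measure_biUnion (Set.to_countable S) ?_
    fun τ _ => Φ.measurableSet_preimage τ]
  · exact measure_mono (Set.iUnion₂_subset hA)
  · refine fun τ hτ τ' hτ' hne => Set.disjoint_left.2 fun X h1 h2 => ?_
    rcases Extends.comparable h1 h2 with h | h
    · exact hne (hS τ hτ τ' hτ' h)
    · exact hne (hS τ' hτ' τ hτ h).symm

/-- Removing `openOf A` turns each preimage into a closed set, a clopen stage minus an open set, so
Cantor's intersection theorem applies. -/
theorem IsStage.exists_mem_toPFun (hE : Φ.IsStage E) {k : ℕ} {A : Set (List Bool)}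
    (hA : lateSet E k ⊆ A) {Y : ℕ → Bool} (hY : ∀ n, ¬ Φ.preimage (initSeg Y n) ⊆ openOf A) :
    ∃ X, X ∉ openOf A ∧ Y ∈ Φ.toPFun X := by
  choose s hs using fun n => hE.exists_isGoodStage k (initSeg Y n)
  have hK (n : ℕ) : stageSet E (initSeg Y n) (s n) \ openOf A =
      Φ.preimage (initSeg Y n) \ openOf A := by
    ext X
    constructor
    · rintro ⟨h1, h2⟩
      refine ⟨?_, h2⟩
      rw [hE.preimage_eq_iUnion]
      exact Set.mem_iUnion.2 ⟨_, h1⟩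
    · rintro ⟨h1, h2⟩
      refine ⟨by_contra fun h => h2 (openOf_mono hA ?_), h2⟩
      exact hE.preimage_sdiff_subset_openOf_lateSet (hs n) ⟨h1, h⟩
  have hclosed (n : ℕ) : IsClosed (Φ.preimage (initSeg Y n) \ openOf A) := by
    rw [← hK]
    exact (isClosed_stageSet _ _ _).sdiff (isOpen_openOf A)
  obtain ⟨X, hX⟩ := IsCompact.nonempty_iInter_of_sequence_nonempty_isCompact_isClosed
    (fun n => Φ.preimage (initSeg Y n) \ openOf A)
    (fun n => Set.sdiff_subset_sdiff_left fun X hX =>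
      Extends.prefix hX (initSeg_prefix Y (Nat.le_succ n)))
    (fun n => Set.sdiff_nonempty.2 (hY n)) (hclosed 0).isCompact hclosed
  rw [Set.mem_iInter] at hX
  exact ⟨X, (hX 0).2, mem_toPFun_iff.2 fun n => (hX n).1⟩

theorem exists_twoRandom_of_semimeasureTwoRandom {Y : ℕ → Bool}
    (hY : SemimeasureTwoRandom Φ.induced Y) : ∃ X, TwoRandom X ∧ Y ∈ Φ.toPFun X := by
  obtain ⟨E, hE⟩ := Φ.exists_isStage
  obtain ⟨U, hU, hUm, hUr⟩ := exists_universal_test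
  -- The shift to `k + 1` lets the two parts together have measure at most `2⁻ᵏ`.
  let A : ℕ → Set (List Bool) := fun k => U (k + 1) ∪ lateSet E (k + 1)
  have hA : IsSigma2 fun x : ℕ × List Bool => x.2 ∈ A x.1 := by
    have hsucc : Primrec fun x : ℕ × List Bool => (x.1 + 1, x.2) :=
      (Primrec.succ.comp Primrec.fst).pair Primrec.snd
    exact (hU.comp hsucc).or (hE.isSigma2_lateSet.comp hsucc)
  have hAm (k : ℕ) : uniformMeasure (openOf (A k)) ≤ 2⁻¹ ^ k := by
    rw [openOf_union]
    refine (measure_union_le _ _).trans ((add_le_add (hUm _) (hE.uniformMeasure_lateSet_le _)).trans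
      (le_of_eq ?_))
    rw [pow_succ, ← mul_add, ENNReal.inv_two_add_inv_two, mul_one]
  have hlate (k : ℕ) : lateSet E (k + 1) ⊆ A k := Set.subset_union_right
  obtain ⟨V, hV, hV'⟩ := IsSigma2.exists_prefixFree
    (V := fun k => {σ | Φ.preimage σ ⊆ openOf (A k)}) (hE.isSigma2_preimage_subset hA hlate)
  have hw (k : ℕ) : weight Φ.induced (V k) ≤ 2⁻¹ ^ k := by
    refine (weight_induced_le (hV' k).2.2 fun τ hτ => ?_).trans (hAm k)
    obtain ⟨σ, hσ, hp⟩ := (hV' k).2.1 τ hτ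
    exact Set.Subset.trans (fun X hX => Extends.prefix hX hp) hσ
  have hYV := hY V (uniformlyHaltingCE_iff.2 hV) hw
  rw [Set.mem_iInter, not_forall] at hYV
  obtain ⟨k, hk⟩ := hYV
  -- Since `Y ∉ ⟦V k⟧`, no initial segment of `Y` has its preimage inside `⟦A k⟧`.
  obtain ⟨X, hXA, hXY⟩ := hE.exists_mem_toPFun (hlate k) (Y := Y) fun n hn =>
    hk ((hV' k).1 (mem_openOf.2 ⟨n, hn⟩))
  exact ⟨X, hUr (k + 1) X fun h => hXA (openOf_mono Set.subset_union_left h), hXY⟩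

end TuringFunctional

end Fibre

theorem mainTheorem4 (ρ : List Bool → ℝ) (hρ : IsSemimeasure ρ) (hce : IsLeftCE ρ)
    (Φ : TuringFunctional) (hΦ : ρ = Φ.induced) :
    (∀ X : ℕ → Bool, TwoRandom X → ∀ hX : X ∈ Φ.toPFun.Dom,
      SemimeasureTwoRandom ρ (Φ.toPFun.fn X hX)) ∧
    (∀ Y : ℕ → Bool, SemimeasureTwoRandom ρ Y → ∃ X : ℕ → Bool, TwoRandom X ∧ Y ∈ Φ.toPFun X) := by
  subst hΦ
  exact ⟨fun X hX hdom => TuringFunctional.semimeasureTwoRandom_of_mem_toPFun hX ⟨hdom, rfl⟩,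
    fun Y hY => TuringFunctional.exists_twoRandom_of_semimeasureTwoRandom hY⟩
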